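/- Let $p\ge 5$ be a prime, $R_p=\widehat{\mathbb Z_p^{ur}}$ the completion of the maximal unramified extension of $\mathbb Z_p$ (equivalently, the ring of Witt vectors of an algebraic closure of $\mathbb F_p$), and $\pi$ a root of a (monic) Eisenstein polynomial of degree $e\ge 2$ over $\mathbb Z_p$ such that $\mathbb Q_p(\pi)/\mathbb Q_p$ is Galois. Put $R_\pi=R_p[\pi]=R_p\otimes_{\mathbb Z_p}\mathbb Z_p[\pi]$, let $\phi$ be the Frobenius of $R_p$, extended to $R_\pi$ by $\phi(\pi)=\pi$, and let $\delta_p x=(\phi(x)-x^p)/p$ on $R_p$ and $\delta_\pi x=(\phi(x)-x^p)/\pi$ on $R_\pi$. For $\varpi\in\{p,\pi\}$, a $\varpi$-derivation $\delta:A\to B$ along a homomorphism $A\to B$ (of $R_\varpi$-algebras) is a map with $\delta(1)=0$, $\delta(x+y)=\delta x+\delta y+\frac{x^p+y^p-(x+y)^p}{\varpi}$ (where the fraction denotes the corresponding polynomial with coefficients in $\mathbb Z_p[\varpi]$) and $\delta(xy)=x^p\delta y+y^p\delta x+\varpi\,\delta x\,\delta y$. A $\delta_\varpi$-prolongation sequence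 is a sequence of $R_\varpi$-algebras $S^0\to S^1\to S^2\to\cdots$ with $\varpi$-derivations $\delta:S^n\to S^{n+1}$ along the structure maps which commute with the structure maps and extend $\delta_\varpi$ on $R_\varpi$. An $R_\varpi$-algebra $A$ has a universal $\delta_\varpi$-prolongation sequence $(A^n)_{n\ge0}$ with $A^0=A$. For a scheme $Y$ smooth over $R_\varpi$, the jet space $J^n_\varpi(Y)$ is the formal scheme glued from the $\mathrm{Spf}\,\widehat{\mathcal O(U)^n}$, $U\subset Y$ affine open, where $\widehat{\ }$ is $p$-adic completion; $\mathcal O(J^n_\varpi(Y))$ is its ring of global functions. Let $X$ be a smooth scheme over $R_p$, $X_{R_\pi}=X\otimes_{R_p}R_\pi$ and $n\ge 0$. A $\delta_p$-prolongation sequence $S^*$ with flat terms makes $S^*\otimes_{R_p}R_\pi$ a $\delta_\pi$-prolongation sequence, by $\delta_\pi z=((\phi\otimes\phi)(z)-z^p)/\pi$, where $\phi(x)=x^p+p\,\delta_p x$ on $S^*$. By the universal property of $\pi$-jets this gives a canonical ring homomorphism $$\iota:\ \mathcal O(J^n_\pi(X_{R_\pi}))\longrightarrow \mathcal O(J^n_p(X))\otimes_{R_p}R_\pi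 .$$ Let $\tau_\pi=(1\otimes \mathrm{Tr}_{R_\pi/R_p})\circ\iota:\mathcal O(J^n_\pi(X_{R_\pi}))\to\mathcal O(J^n_p(X))$ be the arithmetic trace. Then for every $f\in\mathcal O(J^n_p(X))$ the following are equivalent: 1) there is an integer $\nu\ge0$ such that $p^\nu f$ belongs to the image of $\tau_\pi$; 2) there is an integer $\nu\ge0$ such that $p^\nu f\otimes 1$ belongs to the image of $\iota$. -/

import Mathlib

set_option linter.unusedSimpArgs false
set_option linter.unusedSectionVars false

open scoped TensorProduct

universe u

noncomputable section

namespace PiJet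

section

/-- The integral polynomial `C_p(x,y) = (x^p + y^p - (x+y)^p)/p`, evaluated in a commutative ring. -/
def Cp (p : ℕ) {B : Type*} [CommRing B] (x y : B) : B :=
  -∑ i ∈ Finset.Ioo 0 p, ((p.choose i / p : ℕ) : B) * x ^ i * y ^ (p - i)

lemma p_mul_Cp (p : ℕ) [Fact p.Prime] {B : Type*} [CommRing B] (x y : B) :
    (p : B) * Cp p x y = x ^ p + y ^ p - (x + y) ^ p := by
  have hp : p.Prime := Fact.out
  have h1 : Finset.range (p + 1) = insert 0 (insert p (Finset.Ioo 0 p)) := by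
    ext i; simp; have := hp.pos; omega
  rw [add_pow, h1, Finset.sum_insert (by simp [hp.ne_zero.symm]), Finset.sum_insert (by simp), Cp,
    mul_neg, Finset.mul_sum]
  have h2 : ∑ i ∈ Finset.Ioo 0 p, (p : B) * (((p.choose i / p : ℕ) : B) * x ^ i * y ^ (p - i)) =
      ∑ i ∈ Finset.Ioo 0 p, x ^ i * y ^ (p - i) * (p.choose i : B) := by
    refine Finset.sum_congr rfl fun i hi => ?_
    rw [Finset.mem_Ioo] at hi
    have hd : p ∣ p.choose i := hp.dvd_choose_self hi.1.ne' hi.2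
    have h3 : (p : B) * ((p.choose i / p : ℕ) : B) = (p.choose i : B) := by
      rw [← Nat.cast_mul, Nat.mul_div_cancel' hd]
    rw [← h3]; ring
  rw [h2]; simp; ring

lemma map_Cp (p : ℕ) {A B : Type*} [CommRing A] [CommRing B] (f : A →+* B) (x y : A) :
    f (Cp p x y) = Cp p (f x) (f y) := by
  simp [Cp]

section
variable (p : ℕ) [Fact p.Prime] {B : Type*} [CommRing B]

/-- Cancel `p` in an integral polynomial ring. -/
lemma cancel_p {x y : MvPolynomial (Fin 3) ℤ}
    (h : (p : MvPolynomial (Fin 3) ℤ) * x = (p : MvPolynomial (Fin 3) ℤ) * y) : x = y := by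
  have hp : (p : MvPolynomial (Fin 3) ℤ) ≠ 0 := by
    exact_mod_cast (Fact.out : p.Prime).ne_zero
  exact mul_left_cancel₀ hp h

lemma Cp_comm (x y : B) : Cp p x y = Cp p y x := by
  have h : Cp p (MvPolynomial.X 0 : MvPolynomial (Fin 3) ℤ) (MvPolynomial.X 1) =
      Cp p (MvPolynomial.X 1) (MvPolynomial.X 0) := by
    apply cancel_p p; rw [p_mul_Cp, p_mul_Cp]; ring
  have h' := congrArg (MvPolynomial.eval₂Hom (Int.castRingHom B) ![x, y, 0]) h
  simp only [map_Cp, map_add, map_mul, map_pow, map_zero, MvPolynomial.eval₂Hom_X'] at h'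
  simpa using h'

lemma Cp_assoc (x y z : B) : Cp p x y + Cp p (x + y) z = Cp p y z + Cp p x (y + z) := by
  have h : Cp p (MvPolynomial.X 0 : MvPolynomial (Fin 3) ℤ) (MvPolynomial.X 1) +
      Cp p (MvPolynomial.X 0 + MvPolynomial.X 1) (MvPolynomial.X 2) =
      Cp p (MvPolynomial.X 1) (MvPolynomial.X 2) +
        Cp p (MvPolynomial.X 0) (MvPolynomial.X 1 + MvPolynomial.X 2) := by
    apply cancel_p p; simp only [mul_add, p_mul_Cp]; ring
  have h' := congrArg (MvPolynomial.eval₂Hom (Int.castRingHom B) ![x, y, z]) h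
  simp only [map_Cp, map_add, map_mul, map_pow, map_zero, MvPolynomial.eval₂Hom_X'] at h'
  simpa using h'

lemma Cp_mul (a x y : B) : Cp p (a * x) (a * y) = a ^ p * Cp p x y := by
  have h : Cp p ((MvPolynomial.X 0 : MvPolynomial (Fin 3) ℤ) * MvPolynomial.X 1)
        (MvPolynomial.X 0 * MvPolynomial.X 2) =
      MvPolynomial.X 0 ^ p * Cp p (MvPolynomial.X 1) (MvPolynomial.X 2) := by
    apply cancel_p p; rw [mul_left_comm]; simp only [p_mul_Cp, ← mul_add, mul_pow]; ring
  have h' := congrArg (MvPolynomial.eval₂Hom (Int.castRingHom B) ![a, x, y]) h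
  simp only [map_Cp, map_add, map_mul, map_pow, map_zero, MvPolynomial.eval₂Hom_X'] at h'
  simpa using h'

lemma Cp_zero_left (y : B) : Cp p 0 y = 0 := by
  have h : Cp p (0 : MvPolynomial (Fin 3) ℤ) (MvPolynomial.X 1) = 0 := by
    apply cancel_p p; rw [p_mul_Cp]; simp [(Fact.out : p.Prime).ne_zero]
  have h' := congrArg (MvPolynomial.eval₂Hom (Int.castRingHom B) ![0, y, 0]) h
  simp only [map_Cp, map_add, map_mul, map_pow, map_zero, MvPolynomial.eval₂Hom_X'] at h'
  simpa using h'

end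

/-- A `ϖ`-derivation `δ : A → B` along `φ : A →+* B`, for elements `ϖ`, `c` of `B` with
`ϖ * c = p`: the polynomial `C_ϖ = (X^p + Y^p - (X+Y)^p)/ϖ` is `c * C_p`. -/
structure IsPiDer (p : ℕ) {A B : Type*} [CommRing A] [CommRing B] (ϖ c : B) (φ : A →+* B)
    (δ : A → B) : Prop where
  map_one : δ 1 = 0
  map_add : ∀ x y, δ (x + y) = δ x + δ y + c * Cp p (φ x) (φ y)
  map_mul : ∀ x y, δ (x * y) = φ x ^ p * δ y + φ y ^ p * δ x + ϖ * δ x * δ y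

/-- A base ring `R` with an element `ϖ` dividing `p` (`c` is the quotient `p / ϖ`) and a
`ϖ`-derivation `δ : R → R`. -/
structure DeltaBase (p : ℕ) (R : Type u) [CommRing R] where
  ϖ : R
  c : R
  ϖ_mul_c : ϖ * c = p
  δ : R → R
  isPiDer : IsPiDer p ϖ c (RingHom.id R) δ

variable {p : ℕ} {R : Type u} [CommRing R] (D : DeltaBase p R)

namespace DeltaBase
/-- The image of `ϖ` in an `R`-algebra. -/
abbrev ϖIn (B : Type*) [CommRing B] [Algebra R B] : B := algebraMap R B D.ϖ
/-- The image of `p / ϖ` in an `R`-algebra. -/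
abbrev cIn (B : Type*) [CommRing B] [Algebra R B] : B := algebraMap R B D.c

lemma ϖIn_mul_cIn (B : Type*) [CommRing B] [Algebra R B] : D.ϖIn B * D.cIn B = p := by
  rw [ϖIn, cIn, ← map_mul, D.ϖ_mul_c, map_natCast]
end DeltaBase

/-- The `ϖ`-typical Witt vectors of length two over `B`. A ring homomorphism `A → W2 D B` is the
same as a ring homomorphism `A → B` together with a `ϖ`-derivation along it. -/
@[ext] structure W2 {p : ℕ} {R : Type u} [CommRing R] (D : DeltaBase p R) (B : Type*) where
  fst : B
  snd : B

namespace W2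
variable {D}
variable {B : Type*} [CommRing B] [Algebra R B]
instance : Zero (W2 D B) := ⟨⟨0, 0⟩⟩
instance : One (W2 D B) := ⟨⟨1, 0⟩⟩
instance : Add (W2 D B) := ⟨fun a b => ⟨a.fst + b.fst, a.snd + b.snd + D.cIn B * Cp p a.fst b.fst⟩⟩
instance : Neg (W2 D B) := ⟨fun a => ⟨-a.fst, -a.snd - D.cIn B * Cp p a.fst (-a.fst)⟩⟩
instance : Mul (W2 D B) :=
  ⟨fun a b => ⟨a.fst * b.fst, a.fst ^ p * b.snd + b.fst ^ p * a.snd + D.ϖIn B * a.snd * b.snd⟩⟩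
@[simp] lemma zero_fst : (0 : W2 D B).fst = 0 := rfl
@[simp] lemma zero_snd : (0 : W2 D B).snd = 0 := rfl
@[simp] lemma one_fst : (1 : W2 D B).fst = 1 := rfl
@[simp] lemma one_snd : (1 : W2 D B).snd = 0 := rfl
@[simp] lemma add_fst (a b : W2 D B) : (a + b).fst = a.fst + b.fst := rfl
@[simp] lemma add_snd (a b : W2 D B) :
    (a + b).snd = a.snd + b.snd + D.cIn B * Cp p a.fst b.fst := rfl
@[simp] lemma neg_fst (a : W2 D B) : (-a).fst = -a.fst := rfl
@[simp] lemma neg_snd (a : W2 D B) : (-a).snd = -a.snd - D.cIn B * Cp p a.fst (-a.fst) := rfl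
@[simp] lemma mul_fst (a b : W2 D B) : (a * b).fst = a.fst * b.fst := rfl
@[simp] lemma mul_snd (a b : W2 D B) : (a * b).snd =
    a.fst ^ p * b.snd + b.fst ^ p * a.snd + D.ϖIn B * a.snd * b.snd := rfl

variable [Fact p.Prime]

lemma add_comm' (a b : W2 D B) : a + b = b + a := by
  ext
  · simp [add_comm]
  · simp only [add_snd, Cp_comm p a.fst b.fst]; ring

lemma mul_comm' (a b : W2 D B) : a * b = b * a := by
  ext <;> simp only [mul_fst, mul_snd] <;> ring

lemma mul_add' (a b c : W2 D B) : a * (b + c) = a * b + a * c := by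
  ext
  · simp [mul_add]
  · simp only [mul_snd, add_snd, add_fst, mul_fst, Cp_mul]
    have h1 := p_mul_Cp p b.fst c.fst
    have h2 := D.ϖIn_mul_cIn B
    rw [← h2] at h1
    linear_combination a.snd * h1

instance : CommRing (W2 D B) where
  add_assoc a b c := by
    ext
    · simp [add_assoc]
    · simp only [add_snd, add_fst]
      linear_combination (D.cIn B) * Cp_assoc p a.fst b.fst c.fst
  zero_add a := by ext <;> simp [Cp_zero_left]
  add_zero a := by rw [add_comm']; ext <;> simp [Cp_zero_left]
  add_comm := add_comm'
  nsmul := nsmulRec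
  zsmul := zsmulRec
  neg_add_cancel a := by
    rw [add_comm']; ext
    · simp
    · simp only [add_snd, neg_snd, neg_fst, zero_snd]; ring
  left_distrib := mul_add'
  right_distrib a b c := by rw [mul_comm', mul_add', mul_comm' c, mul_comm' c]
  zero_mul a := by ext <;> simp [(Fact.out : p.Prime).ne_zero]
  mul_zero a := by ext <;> simp [(Fact.out : p.Prime).ne_zero]
  mul_assoc a b c := by
    ext
    · simp [mul_assoc]
    · simp only [mul_snd, mul_fst, mul_pow]; ring
  one_mul a := by ext <;> simp
  mul_one a := by ext <;> simp
  mul_comm := mul_comm'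

/-- The projection to the first coordinate. -/
def fstHom : W2 D B →+* B where
  toFun := W2.fst
  map_zero' := rfl
  map_one' := rfl
  map_add' _ _ := rfl
  map_mul' _ _ := rfl

/-- Functoriality of `W2` in the algebra. -/
def map {C : Type*} [CommRing C] [Algebra R C] (f : B →ₐ[R] C) : W2 D B →+* W2 D C where
  toFun a := ⟨f a.fst, f a.snd⟩
  map_zero' := by ext <;> simp
  map_one' := by ext <;> simp
  map_add' a b := by
    ext
    · simp
    · have := map_Cp p (f : B →+* C) a.fst b.fst
      simp only [AlgHom.coe_toRingHom] at this
      simp [this]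
  map_mul' a b := by ext <;> simp

end W2

section
variable [Fact p.Prime] {D} {A B : Type*} [CommRing A] [CommRing B] [Algebra R B]

lemma IsPiDer.map_zero {ϖ c : B} {φ : A →+* B} {δ : A → B} (h : IsPiDer p ϖ c φ δ) : δ 0 = 0 := by
  have := h.map_add 0 0
  simpa [Cp_zero_left] using this

/-- The ring homomorphism to `W2` attached to a `ϖ`-derivation. -/
def IsPiDer.toW2 {φ : A →+* B} {δ : A → B}
    (h : IsPiDer p (D.ϖIn B) (D.cIn B) φ δ) : A →+* W2 D B where
  toFun x := ⟨φ x, δ x⟩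
  map_zero' := by ext <;> simp [h.map_zero]
  map_one' := by ext <;> simp [h.map_one]
  map_add' x y := by ext <;> simp [h.map_add]
  map_mul' x y := by ext <;> simp [h.map_mul]

/-- The second coordinate of a ring homomorphism to `W2` is a `ϖ`-derivation along the first. -/
lemma isPiDer_snd (H : A →+* W2 D B) (φ : A →+* B) (hφ : ∀ x, (H x).fst = φ x) :
    IsPiDer p (D.ϖIn B) (D.cIn B) φ (fun x => (H x).snd) where
  map_one := by simp
  map_add x y := by simp [hφ]
  map_mul x y := by simp [hφ]

end

end

section

variable {p : ℕ} {R : Type u} [CommRing R] (D : DeltaBase p R)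

/-- A prolongation sequence over the base `(R, δ)`: `R`-algebras `S^n`, structure maps
`S^n → S^{n+1}` and `ϖ`-derivations `δ : S^n → S^{n+1}` along them which commute with the structure
maps and extend the `ϖ`-derivation of `R`. -/
structure Prolongation where
  obj : ℕ → Type u
  [ring : ∀ n, CommRing (obj n)]
  [alg : ∀ n, Algebra R (obj n)]
  incl : ∀ n, obj n →ₐ[R] obj (n + 1)
  δ : ∀ n, obj n → obj (n + 1)
  isPiDer : ∀ n, IsPiDer p (D.ϖIn (obj (n + 1))) (D.cIn (obj (n + 1)))
    (incl n : obj n →+* obj (n + 1)) (δ n)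
  δ_incl : ∀ n x, δ (n + 1) (incl n x) = incl (n + 1) (δ n x)
  δ_algebraMap : ∀ n r, δ n (algebraMap R (obj n) r) = algebraMap R (obj (n + 1)) (D.δ r)

attribute [instance] Prolongation.ring Prolongation.alg

/-- A morphism of prolongation sequences. -/
@[ext] structure Prolongation.Hom {D : DeltaBase p R} (S T : Prolongation D) where
  app : ∀ n, S.obj n →ₐ[R] T.obj n
  app_incl : ∀ n x, app (n + 1) (S.incl n x) = T.incl n (app n x)
  app_δ : ∀ n x, app (n + 1) (S.δ n x) = T.δ n (app n x)

/-- Composition of morphisms of prolongation sequences. -/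
def Prolongation.Hom.comp {D : DeltaBase p R} {S T U : Prolongation D} (g : T.Hom U) (f : S.Hom T) :
    S.Hom U where
  app n := (g.app n).comp (f.app n)
  app_incl n x := by simp [f.app_incl, g.app_incl]
  app_δ n x := by simp [f.app_δ, g.app_δ]

/-- Two consecutive terms of a prolongation sequence under construction. -/
structure Stage (R : Type u) [CommRing R] where
  A : Type u
  B : Type u
  [ringA : CommRing A]
  [ringB : CommRing B]
  [algA : Algebra R A]
  [algB : Algebra R B]
  incl : A →ₐ[R] B
  δ : A → B

attribute [instance] Stage.ringA Stage.ringB Stage.algA Stage.algB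

section Step
variable (T : Stage R)
open MvPolynomial

/-- The relations, in the polynomial ring over `B` on symbols `X_b` (`b ∈ B`), which say that
`b ↦ X_b` is a `ϖ`-derivation and that `X_{incl a} = δ a` for `a ∈ A`. -/
def stepIdeal : Ideal (MvPolynomial T.B T.B) :=
  Ideal.span
    ({q | q = X 1} ∪
     {q | ∃ x y : T.B, q = X (x + y) - (X x + X y + C (D.cIn T.B * Cp p x y))} ∪
     {q | ∃ x y : T.B, q = X (x * y) -
        (C (x ^ p) * X y + C (y ^ p) * X x + C (D.ϖIn T.B) * X x * X y)} ∪
     {q | ∃ a : T.A, q = X (T.incl a) - C (T.δ a)})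

/-- The `B`-algebra freely generated by a `ϖ`-derivation on `B` extending the one on `A`. -/
def Step : Type u := MvPolynomial T.B T.B ⧸ stepIdeal D T

instance : CommRing (Step D T) := inferInstanceAs (CommRing (MvPolynomial T.B T.B ⧸ stepIdeal D T))
instance : Algebra R (Step D T) :=
  inferInstanceAs (Algebra R (MvPolynomial T.B T.B ⧸ stepIdeal D T))

/-- The quotient map. -/
def Step.mk : MvPolynomial T.B T.B →ₐ[R] Step D T := Ideal.Quotient.mkₐ R (stepIdeal D T)

/-- The structure map `B → Step`. -/
def Step.incl : T.B →ₐ[R] Step D T := (Step.mk D T).comp (IsScalarTower.toAlgHom R T.B _)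

/-- The universal `ϖ`-derivation `B → Step`. -/
def Step.δ (b : T.B) : Step D T := Step.mk D T (X b)

lemma Step.mk_C (b : T.B) : Step.mk D T (C b) = Step.incl D T b := rfl
lemma Step.mk_X (b : T.B) : Step.mk D T (X b) = Step.δ D T b := rfl

lemma Step.mk_eq {q r : MvPolynomial T.B T.B} (h : q - r ∈ stepIdeal D T) :
    Step.mk D T q = Step.mk D T r := Ideal.Quotient.eq.2 h

lemma Step.isPiDer : IsPiDer p (D.ϖIn (Step D T)) (D.cIn (Step D T))
    (Step.incl D T : T.B →+* Step D T) (Step.δ D T) where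
  map_one := by
    have h : Step.mk D T (X 1) = Step.mk D T 0 := by
      apply Step.mk_eq; rw [sub_zero]
      exact Ideal.subset_span (Or.inl (Or.inl (Or.inl rfl)))
    simpa [Step.mk_X] using h
  map_add x y := by
    have h : Step.mk D T (X (x + y)) = Step.mk D T (X x + X y + C (D.cIn T.B * Cp p x y)) := by
      apply Step.mk_eq
      exact Ideal.subset_span (Or.inl (Or.inl (Or.inr ⟨x, y, rfl⟩)))
    simp only [map_add, Step.mk_X, Step.mk_C, map_mul] at h
    rw [h, ← map_Cp]; simp
  map_mul x y := by
    have h : Step.mk D T (X (x * y)) = Step.mk D T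
        (C (x ^ p) * X y + C (y ^ p) * X x + C (D.ϖIn T.B) * X x * X y) := by
      apply Step.mk_eq
      exact Ideal.subset_span (Or.inl (Or.inr ⟨x, y, rfl⟩))
    rw [map_add, map_add, map_mul, map_mul, map_mul, map_mul] at h
    simp only [Step.mk_X, Step.mk_C] at h
    rw [h]; simp

lemma Step.δ_incl (a : T.A) : Step.δ D T (T.incl a) = Step.incl D T (T.δ a) :=
  Step.mk_eq D T (Ideal.subset_span (Or.inr ⟨a, rfl⟩))

/-- The universal property of `Step`. -/
def Step.lift {B C : Type u} [CommRing B] [CommRing C] [Algebra R B] [Algebra R C]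
    (u : T.B →ₐ[R] B) (i : B →ₐ[R] C) (d : B → C)
    (hd : IsPiDer p (D.ϖIn C) (D.cIn C) (i : B →+* C) d)
    (h : ∀ a, d (u (T.incl a)) = i (u (T.δ a))) : Step D T →ₐ[R] C :=
  Ideal.Quotient.liftₐ (stepIdeal D T)
    ({ MvPolynomial.eval₂Hom ((i.comp u : T.B →ₐ[R] C) : T.B →+* C) (fun b => d (u b)) with
        commutes' := fun r => by
          change MvPolynomial.eval₂Hom ((i.comp u : T.B →ₐ[R] C) : T.B →+* C) _
            (algebraMap R (MvPolynomial T.B T.B) r) = _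
          rw [IsScalarTower.algebraMap_apply R T.B (MvPolynomial T.B T.B), MvPolynomial.algebraMap_eq,
            MvPolynomial.eval₂Hom_C]
          simp } : MvPolynomial T.B T.B →ₐ[R] C)
    (by
      intro q hq
      change MvPolynomial.eval₂Hom ((i.comp u : T.B →ₐ[R] C) : T.B →+* C) (fun b => d (u b)) q = 0
      rw [← RingHom.mem_ker]
      refine Ideal.span_le.2 ?_ hq
      rintro q (((rfl | ⟨x, y, rfl⟩) | ⟨x, y, rfl⟩) | ⟨a, rfl⟩)
      · simp [RingHom.mem_ker, hd.map_one]
      · have := map_Cp p (u : T.B →+* B) x y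
        have h2 := map_Cp p (i : B →+* C) (u x) (u y)
        simp only [AlgHom.coe_toRingHom] at this h2
        simp [RingHom.mem_ker, hd.map_add, this, h2]
      · simp [RingHom.mem_ker, hd.map_mul]
      · simp [RingHom.mem_ker, h])

lemma Step.lift_incl {B C : Type u} [CommRing B] [CommRing C] [Algebra R B] [Algebra R C]
    (u : T.B →ₐ[R] B) (i : B →ₐ[R] C) (d : B → C) (hd) (h) (b : T.B) :
    Step.lift D T u i d hd h (Step.incl D T b) = i (u b) :=
  MvPolynomial.eval₂Hom_C _ _ _

lemma Step.lift_δ {B C : Type u} [CommRing B] [CommRing C] [Algebra R B] [Algebra R C]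
    (u : T.B →ₐ[R] B) (i : B →ₐ[R] C) (d : B → C) (hd) (h) (b : T.B) :
    Step.lift D T u i d hd h (Step.δ D T b) = d (u b) :=
  MvPolynomial.eval₂Hom_X' _ _ _

lemma Step.hom_ext {C : Type u} [CommRing C] [Algebra R C] {f g : Step D T →ₐ[R] C}
    (h1 : ∀ b, f (Step.incl D T b) = g (Step.incl D T b))
    (h2 : ∀ b, f (Step.δ D T b) = g (Step.δ D T b)) : f = g := by
  have : ((f : Step D T →+* C).comp (Step.mk D T).toRingHom) =
      ((g : Step D T →+* C).comp (Step.mk D T).toRingHom) := by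
    apply MvPolynomial.ringHom_ext
    · intro b; exact h1 b
    · intro b; exact h2 b
  ext x
  obtain ⟨q, rfl⟩ := Ideal.Quotient.mk_surjective x
  exact congrArg (fun k => k q) this

end Step

section Jet
variable (A : Type u) [CommRing A] [Algebra R A]

/-- The stages of the universal prolongation sequence: stage `0` is `R → A`, with the
`ϖ`-derivation of `R`, and stage `n + 1` freely adjoins a `ϖ`-derivation to stage `n`. -/
def jetStage : ℕ → Stage R
  | 0 => { A := R, B := A, incl := Algebra.ofId R A, δ := fun r => algebraMap R A (D.δ r) }
  | n + 1 => { A := (jetStage n).B, B := Step D (jetStage n), incl := Step.incl D (jetStage n),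
               δ := Step.δ D (jetStage n) }

/-- The `n`-th term `A^n` of the universal prolongation sequence with `A^0 = A`. -/
def Jet (n : ℕ) : Type u := (jetStage D A n).B

instance (n : ℕ) : CommRing (Jet D A n) := (jetStage D A n).ringB
instance (n : ℕ) : Algebra R (Jet D A n) := (jetStage D A n).algB

/-- The identification `A = A^0`. -/
def Jet.zeroEquiv : A ≃ₐ[R] Jet D A 0 := AlgEquiv.refl

/-- The structure map `A^n → A^{n+1}`. -/
def Jet.incl (n : ℕ) : Jet D A n →ₐ[R] Jet D A (n + 1) := Step.incl D (jetStage D A n)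

/-- The `ϖ`-derivation `A^n → A^{n+1}`. -/
def Jet.δ (n : ℕ) : Jet D A n → Jet D A (n + 1) := Step.δ D (jetStage D A n)

lemma Jet.isPiDer (n : ℕ) : IsPiDer p (D.ϖIn (Jet D A (n + 1))) (D.cIn (Jet D A (n + 1)))
    (Jet.incl D A n : Jet D A n →+* Jet D A (n + 1)) (Jet.δ D A n) :=
  Step.isPiDer D (jetStage D A n)

lemma Jet.δ_incl (n : ℕ) (x : Jet D A n) :
    Jet.δ D A (n + 1) (Jet.incl D A n x) = Jet.incl D A (n + 1) (Jet.δ D A n x) :=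
  Step.δ_incl D (jetStage D A (n + 1)) x

lemma Jet.δ_algebraMap (n : ℕ) (r : R) : Jet.δ D A n (algebraMap R (Jet D A n) r) =
    algebraMap R (Jet D A (n + 1)) (D.δ r) := by
  induction n with
  | zero =>
    have h := Step.δ_incl D (jetStage D A 0) r
    have h' : Step.incl D (jetStage D A 0) (algebraMap R A (D.δ r)) =
      algebraMap R (Jet D A 1) (D.δ r) := (Jet.incl D A 0).commutes (D.δ r)
    exact h.trans h'
  | succ n ih =>
    rw [← (Jet.incl D A n).commutes, Jet.δ_incl, ih, (Jet.incl D A (n + 1)).commutes]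

/-- The universal prolongation sequence `A^*` of an `R`-algebra `A`. -/
abbrev jetProlongation : Prolongation D where
  obj := Jet D A
  incl := Jet.incl D A
  δ := Jet.δ D A
  isPiDer := Jet.isPiDer D A
  δ_incl := Jet.δ_incl D A
  δ_algebraMap := Jet.δ_algebraMap D A

variable {D A} (S : Prolongation D) (u : A →ₐ[R] S.obj 0)

/-- Auxiliary recursion for `Jet.lift`. -/
def Jet.liftAux : (n : ℕ) → {f : Jet D A n →ₐ[R] S.obj n //
    ∀ a : (jetStage D A n).A, S.δ n (f ((jetStage D A n).incl a)) =
      S.incl n (f ((jetStage D A n).δ a))}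
  | 0 => ⟨u.comp (Jet.zeroEquiv D A).symm.toAlgHom, fun r => by
      have h1 : (u.comp (Jet.zeroEquiv D A).symm.toAlgHom) ((jetStage D A 0).incl r) =
        algebraMap R (S.obj 0) r := u.commutes r
      have h2 : (u.comp (Jet.zeroEquiv D A).symm.toAlgHom) ((jetStage D A 0).δ r) =
        algebraMap R (S.obj 0) (D.δ r) := u.commutes _
      exact (congrArg (S.δ 0) h1).trans ((S.δ_algebraMap 0 r).trans
        (((S.incl 0).commutes _).symm.trans (congrArg (S.incl 0) h2.symm)))⟩
  | n + 1 => ⟨Step.lift D (jetStage D A n) (Jet.liftAux n).1 (S.incl n) (S.δ n) (S.isPiDer n)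
      (Jet.liftAux n).2, fun a => by
      have h1 := Step.lift_incl D (jetStage D A n) (Jet.liftAux n).1 (S.incl n) (S.δ n)
        (S.isPiDer n) (Jet.liftAux n).2 a
      have h2 := Step.lift_δ D (jetStage D A n) (Jet.liftAux n).1 (S.incl n) (S.δ n)
        (S.isPiDer n) (Jet.liftAux n).2 a
      refine (congrArg (S.δ (n + 1)) h1).trans ?_
      refine Eq.trans ?_ (congrArg (S.incl (n + 1)) h2).symm
      exact S.δ_incl n _⟩

/-- The universal property of `A^*`: an `R`-algebra homomorphism `u : A → S^0` extends to a morphism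
of prolongation sequences `A^* → S^*` (which is unique by `Jet.hom_ext`). -/
def Jet.lift : (jetProlongation D A).Hom S where
  app n := (Jet.liftAux S u n).1
  app_incl n x := Step.lift_incl D (jetStage D A n) (Jet.liftAux S u n).1 (S.incl n) (S.δ n)
    (S.isPiDer n) (Jet.liftAux S u n).2 x
  app_δ n x := Step.lift_δ D (jetStage D A n) (Jet.liftAux S u n).1 (S.incl n) (S.δ n)
    (S.isPiDer n) (Jet.liftAux S u n).2 x

lemma Jet.lift_zero (a : A) : (Jet.lift S u).app 0 (Jet.zeroEquiv D A a) = u a := rfl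

lemma Jet.hom_ext {S : Prolongation D} (f g : (jetProlongation D A).Hom S)
    (h0 : ∀ a, f.app 0 (Jet.zeroEquiv D A a) = g.app 0 (Jet.zeroEquiv D A a)) : f = g := by
  apply Prolongation.Hom.ext
  funext n
  induction n with
  | zero => ext x; exact h0 x
  | succ n ih =>
    apply Step.hom_ext D (jetStage D A n)
    · intro b
      exact (f.app_incl n b).trans ((congrArg (fun k => S.incl n (k b)) ih).trans
        (g.app_incl n b).symm)
    · intro b
      exact (f.app_δ n b).trans ((congrArg (fun k => S.δ n (k b)) ih).trans (g.app_δ n b).symm)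

variable (D) in
/-- The morphism `A^* → A'^*` induced by an algebra homomorphism `A → A'`. -/
def Jet.mapHom {A' : Type u} [CommRing A'] [Algebra R A'] (u : A →ₐ[R] A') :
    (jetProlongation D A).Hom (jetProlongation D A') :=
  Jet.lift (jetProlongation D A') ((Jet.zeroEquiv D A').toAlgHom.comp u)

variable (D) in
/-- Functoriality of `A ↦ A^n`. -/
def Jet.map {A' : Type u} [CommRing A'] [Algebra R A'] (u : A →ₐ[R] A') (n : ℕ) :
    Jet D A n →ₐ[R] Jet D A' n :=
  (Jet.mapHom D u).app n

lemma Jet.mapHom_comp {A' A'' : Type u} [CommRing A'] [Algebra R A'] [CommRing A''] [Algebra R A'']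
    (w : A' →ₐ[R] A'') (v : A →ₐ[R] A') :
    Jet.mapHom D (w.comp v) = (Jet.mapHom D w).comp (Jet.mapHom D v) :=
  Jet.hom_ext _ _ fun _ => rfl

lemma Jet.map_comp {A' A'' : Type u} [CommRing A'] [Algebra R A'] [CommRing A''] [Algebra R A'']
    (w : A' →ₐ[R] A'') (v : A →ₐ[R] A') (n : ℕ) :
    Jet.map D (w.comp v) n = (Jet.map D w n).comp (Jet.map D v n) :=
  congrArg (fun k => Prolongation.Hom.app k n) (Jet.mapHom_comp (D := D) w v)

end Jet

end

section

variable {p : ℕ} {R : Type u} [CommRing R] {D : DeltaBase p R}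
variable {R' : Type u} [CommRing R'] [Algebra R R'] {D' : DeltaBase p R'}

/-- Compatibility of the bases `(R, p, δ_p)` and `(R', ϖ, δ_ϖ)` for an `R`-algebra `R'`:
`δ_ϖ r = (p/ϖ) δ_p r` for `r ∈ R`. -/
structure DeltaBase.IsExt (D : DeltaBase p R) (D' : DeltaBase p R') : Prop where
  ϖ_eq : D.ϖ = p
  c_eq : D.c = 1
  δ_algebraMap : ∀ r, D'.δ (algebraMap R R' r) = D'.c * algebraMap R R' (D.δ r)

section tensor
variable [Fact p.Prime]

/-- `R' → W2 (R' ⊗ B)`, `r ↦ (r ⊗ 1, δ r ⊗ 1)`. -/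
def tensorLeft (B : Type u) [CommRing B] [Algebra R B] : R' →+* W2 D' (R' ⊗[R] B) :=
  IsPiDer.toW2 (D := D') (φ := algebraMap R' (R' ⊗[R] B))
    (δ := fun r => algebraMap R' (R' ⊗[R] B) (D'.δ r))
    { map_one := by simp [D'.isPiDer.map_one]
      map_add := fun x y => by
        rw [D'.isPiDer.map_add, map_add, map_add, map_mul, map_Cp]; rfl
      map_mul := fun x y => by
        rw [D'.isPiDer.map_mul, map_add, map_add, map_mul, map_mul, map_mul, map_mul, map_pow,
          map_pow]; rfl }

lemma tensorRight_isPiDer (hD : D.IsExt D') (S : Prolongation D) (n : ℕ) : IsPiDer p (D'.ϖIn (R' ⊗[R] S.obj (n + 1)))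
    (D'.cIn (R' ⊗[R] S.obj (n + 1)))
    ((Algebra.TensorProduct.includeRight : S.obj (n + 1) →ₐ[R] R' ⊗[R] S.obj (n + 1)).toRingHom.comp
      (S.incl n : S.obj n →+* S.obj (n + 1)))
    (fun x => D'.c ⊗ₜ[R] S.δ n x) := by
  have hr : ∀ z : S.obj (n + 1), D'.c ⊗ₜ[R] z = D'.cIn (R' ⊗[R] S.obj (n + 1)) *
      (Algebra.TensorProduct.includeRight : S.obj (n + 1) →ₐ[R] R' ⊗[R] S.obj (n + 1)).toRingHom z :=
    fun z => by simp [DeltaBase.cIn]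
  simp only [hr]
  set i := (Algebra.TensorProduct.includeRight :
    S.obj (n + 1) →ₐ[R] R' ⊗[R] S.obj (n + 1)).toRingHom
  have hϖ := D'.ϖIn_mul_cIn (R' ⊗[R] S.obj (n + 1))
  refine ⟨by simp [(S.isPiDer n).map_one], fun x y => ?_, fun x y => ?_⟩
  · rw [(S.isPiDer n).map_add]
    simp only [map_add, map_mul, map_Cp, DeltaBase.cIn, hD.c_eq, map_one, RingHom.comp_apply]
    ring
  · rw [(S.isPiDer n).map_mul]
    have h : i (D.ϖIn (S.obj (n + 1))) = p := by simp [DeltaBase.ϖIn, hD.ϖ_eq]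
    simp only [map_add, map_mul, h, RingHom.comp_apply, map_pow]
    rw [← hϖ]; ring

variable (hD : D.IsExt D') (S : Prolongation D)

/-- The ring homomorphism `R' ⊗ S^n → W2 (R' ⊗ S^{n+1})` which restricts to
`r ↦ (r ⊗ 1, δ_ϖ r ⊗ 1)` and `s ↦ (1 ⊗ s, (p/ϖ) ⊗ δ_p s)`. -/
def tensorW2 (n : ℕ) : R' ⊗[R] S.obj n →+* W2 D' (R' ⊗[R] S.obj (n + 1)) :=
  letI : Algebra R (W2 D' (R' ⊗[R] S.obj (n + 1))) :=
    ((tensorLeft (D' := D') (S.obj (n + 1))).comp (algebraMap R R')).toAlgebra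
  (Algebra.TensorProduct.productMap
    ({ tensorLeft (D' := D') (S.obj (n + 1)) with commutes' := fun _ => rfl } :
      R' →ₐ[R] W2 D' (R' ⊗[R] S.obj (n + 1)))
    ({ (tensorRight_isPiDer hD S n).toW2 with
        commutes' := fun r => by
          change (⟨_, _⟩ : W2 D' (R' ⊗[R] S.obj (n + 1))) = ⟨_, _⟩
          ext
          · have := (IsScalarTower.algebraMap_apply R R' (R' ⊗[R] S.obj (n + 1)) r)
            simp only [AlgHom.toRingHom_eq_coe, RingHom.comp_apply, RingHom.coe_coe,
              AlgHom.commutes]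
            exact this
          · simp only [S.δ_algebraMap, hD.δ_algebraMap]
            rw [Algebra.algebraMap_eq_smul_one, TensorProduct.tmul_smul, TensorProduct.smul_tmul',
              Algebra.TensorProduct.algebraMap_apply, Algebra.smul_def, mul_comm]
            simp } :
      S.obj n →ₐ[R] W2 D' (R' ⊗[R] S.obj (n + 1)))).toRingHom

lemma tensorW2_left (n : ℕ) (r : R') : tensorW2 hD S n (r ⊗ₜ 1) = ⟨r ⊗ₜ 1, D'.δ r ⊗ₜ 1⟩ :=
  letI : Algebra R (W2 D' (R' ⊗[R] S.obj (n + 1))) :=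
    ((tensorLeft (D' := D') (S.obj (n + 1))).comp (algebraMap R R')).toAlgebra
  Algebra.TensorProduct.productMap_left_apply _ _ r

lemma tensorW2_right (n : ℕ) (x : S.obj n) :
    tensorW2 hD S n (1 ⊗ₜ x) = ⟨1 ⊗ₜ S.incl n x, D'.c ⊗ₜ S.δ n x⟩ :=
  letI : Algebra R (W2 D' (R' ⊗[R] S.obj (n + 1))) :=
    ((tensorLeft (D' := D') (S.obj (n + 1))).comp (algebraMap R R')).toAlgebra
  Algebra.TensorProduct.productMap_right_apply _ _ x

variable (R') in
/-- The structure map `R' ⊗ S^n → R' ⊗ S^{n+1}`. -/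
def tensorIncl (n : ℕ) : R' ⊗[R] S.obj n →ₐ[R'] R' ⊗[R] S.obj (n + 1) :=
  Algebra.TensorProduct.map (AlgHom.id R' R') (S.incl n)

lemma tensorW2_fst (n : ℕ) (z : R' ⊗[R] S.obj n) :
    (tensorW2 hD S n z).fst = (tensorIncl R' S n : R' ⊗[R] S.obj n →+* R' ⊗[R] S.obj (n + 1)) z := by
  have : W2.fstHom.comp (tensorW2 hD S n) =
      (tensorIncl R' S n : R' ⊗[R] S.obj n →+* R' ⊗[R] S.obj (n + 1)) := by
    apply Algebra.TensorProduct.ringHom_ext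
    · ext r; simp [W2.fstHom, tensorW2_left, tensorIncl]
    · ext r; simp [W2.fstHom, tensorW2_right, tensorIncl]
  exact congrArg (fun k => k z) this

/-- The `ϖ`-derivation on `R' ⊗ S^*` induced by the `p`-derivation of `S^*`. -/
def tensorδ (n : ℕ) (z : R' ⊗[R] S.obj n) : R' ⊗[R] S.obj (n + 1) := (tensorW2 hD S n z).snd

lemma tensor_isPiDer (n : ℕ) : IsPiDer p (D'.ϖIn (R' ⊗[R] S.obj (n + 1)))
    (D'.cIn (R' ⊗[R] S.obj (n + 1)))
    (tensorIncl R' S n : R' ⊗[R] S.obj n →+* R' ⊗[R] S.obj (n + 1)) (tensorδ hD S n) :=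
  isPiDer_snd (tensorW2 hD S n) _ (tensorW2_fst hD S n)

/-- The prolongation sequence `R' ⊗_R S^*` over `(R', δ_ϖ)`. -/
abbrev tensorProlongation : Prolongation D' where
  obj n := R' ⊗[R] S.obj n
  incl := tensorIncl R' S
  δ := tensorδ hD S
  isPiDer := tensor_isPiDer hD S
  δ_incl n x := by
    have : (tensorW2 hD S (n + 1)).comp
        (tensorIncl R' S n : R' ⊗[R] S.obj n →+* R' ⊗[R] S.obj (n + 1)) =
      (W2.map (tensorIncl R' S (n + 1))).comp (tensorW2 hD S n) := by
      apply Algebra.TensorProduct.ringHom_ext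
      · ext r <;> simp [tensorW2_left, tensorIncl, W2.map]
      · ext r <;> simp [tensorW2_right, tensorIncl, W2.map, S.δ_incl]
    exact congrArg (fun k => (k x).snd) this
  δ_algebraMap n r := by
    change (tensorW2 hD S n (r ⊗ₜ 1)).snd = _
    rw [tensorW2_left]; rfl

/-- The Frobenius lift `x ↦ x^p + ϖ δ x` of a prolongation sequence. -/
def Prolongation.phi {p : ℕ} {R : Type u} [CommRing R] {D : DeltaBase p R} (S : Prolongation D)
    (n : ℕ) (x : S.obj n) : S.obj (n + 1) :=
  S.incl n x ^ p + D.ϖIn (S.obj (n + 1)) * S.δ n x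

/-- The `ϖ`-derivation on `R' ⊗ S^*` is the one for which the Frobenius lift is `φ ⊗ φ`. -/
lemma tensorProlongation_phi (n : ℕ) (r : R') (x : S.obj n) :
    (tensorProlongation hD S).phi n (r ⊗ₜ[R] x : R' ⊗[R] S.obj n) =
      ((r ^ p + D'.ϖ * D'.δ r) ⊗ₜ[R] S.phi n x : R' ⊗[R] S.obj (n + 1)) := by
  have h : tensorW2 hD S n (r ⊗ₜ[R] x) = ⟨r ⊗ₜ 1, D'.δ r ⊗ₜ 1⟩ *
      ⟨1 ⊗ₜ S.incl n x, D'.c ⊗ₜ S.δ n x⟩ := by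
    rw [← tensorW2_left hD S, ← tensorW2_right hD S, ← map_mul]; simp
  have h2 : tensorδ hD S n (r ⊗ₜ[R] x) = _ := congrArg W2.snd h
  change (tensorIncl R' S n (r ⊗ₜ[R] x)) ^ p + D'.ϖIn (R' ⊗[R] S.obj (n + 1)) *
    tensorδ hD S n (r ⊗ₜ[R] x) = _
  rw [h2]
  have hp : (p : R) • (1 : R') = D'.ϖ * D'.c := by
    rw [D'.ϖ_mul_c, Algebra.smul_def]; simp
  simp only [W2.mul_snd, Prolongation.phi, DeltaBase.ϖIn, tensorIncl,
    Algebra.TensorProduct.algebraMap_apply, Algebra.TensorProduct.map_tmul, AlgHom.id_apply,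
    Algebra.TensorProduct.tmul_pow, Algebra.TensorProduct.tmul_mul_tmul, hD.ϖ_eq, map_natCast,
    one_pow, mul_one, one_mul, Algebra.algebraMap_self, RingHom.id_apply, mul_add,
    TensorProduct.add_tmul, TensorProduct.tmul_add]
  have e : ∀ (a : R') (y : S.obj (n + 1)), a ⊗ₜ[R] ((p : S.obj (n + 1)) * y) =
      (D'.ϖ * D'.c * a) ⊗ₜ[R] y := by
    intro a y
    rw [D'.ϖ_mul_c, ← nsmul_eq_mul, ← nsmul_eq_mul, TensorProduct.tmul_smul,
      TensorProduct.smul_tmul']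
  simp only [e]
  have e2 : D'.ϖ * (r ^ p * D'.c) = D'.ϖ * D'.c * r ^ p := by ring
  have e3 : D'.ϖ * (D'.ϖ * D'.δ r * D'.c) = D'.ϖ * D'.c * (D'.ϖ * D'.δ r) := by ring
  simp only [e2, e3]
  abel

/-- Base change of a morphism of prolongation sequences. -/
def tensorHom {S T : Prolongation D} (f : S.Hom T) :
    (tensorProlongation hD S).Hom (tensorProlongation hD T) where
  app n := Algebra.TensorProduct.map (AlgHom.id R' R') (f.app n)
  app_incl n x := by
    change ((Algebra.TensorProduct.map (AlgHom.id R' R') (f.app (n + 1))).comp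
      (Algebra.TensorProduct.map (AlgHom.id R' R') (S.incl n))) x =
      ((Algebra.TensorProduct.map (AlgHom.id R' R') (T.incl n)).comp
      (Algebra.TensorProduct.map (AlgHom.id R' R') (f.app n))) x
    rw [← Algebra.TensorProduct.map_comp, ← Algebra.TensorProduct.map_comp]
    rw [show (f.app (n + 1)).comp (S.incl n) = (T.incl n).comp (f.app n) from
      AlgHom.ext (f.app_incl n)]
  app_δ n x := by
    have : (W2.map (D := D') (Algebra.TensorProduct.map (AlgHom.id R' R') (f.app (n + 1)))).comp
        (tensorW2 hD S n) =
        (tensorW2 hD T n).comp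
          (Algebra.TensorProduct.map (AlgHom.id R' R') (f.app n)).toRingHom := by
      apply Algebra.TensorProduct.ringHom_ext
      · ext r <;> simp [tensorW2_left, W2.map]
      · ext r <;> simp [tensorW2_right, W2.map, f.app_incl, f.app_δ]
    exact congrArg (fun k => (k x).snd) this

end tensor

end

section

section completion

lemma mem_pow_smul_iff (p : ℕ) {T : Type u} [CommRing T] (n : ℕ) (x : T) :
    x ∈ ((Ideal.span {(p : T)}) ^ n • ⊤ : Submodule T T) ↔ (p : T) ^ n ∣ x := by
  rw [Ideal.span_singleton_pow, smul_eq_mul, Ideal.mul_top, Ideal.mem_span_singleton]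

/-- A ring is `p`-adically complete and separated if and only if this holds elementwise. -/
lemma isAdicComplete_iff (p : ℕ) (T : Type u) [CommRing T] :
    IsAdicComplete (Ideal.span {(p : T)}) T ↔
      (∀ x : T, (∀ n : ℕ, (p : T) ^ n ∣ x) → x = 0) ∧
      (∀ f : ℕ → T, (∀ m n, m ≤ n → (p : T) ^ m ∣ f m - f n) →
        ∃ L, ∀ n, (p : T) ^ n ∣ f n - L) := by
  constructor
  · intro h
    refine ⟨fun x hx => h.toIsHausdorff.haus x fun n => ?_, fun f hf => ?_⟩
    · rw [SModEq.zero, mem_pow_smul_iff]; exact hx n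
    · obtain ⟨L, hL⟩ := h.toIsPrecomplete.prec (f := f) (fun {m n} hmn => by
        rw [SModEq.sub_mem, mem_pow_smul_iff]; exact hf m n hmn)
      exact ⟨L, fun n => by rw [← mem_pow_smul_iff, ← SModEq.sub_mem]; exact hL n⟩
  · rintro ⟨h1, h2⟩
    refine { haus' := fun x hx => h1 x fun n => ?_, prec' := fun f hf => ?_ }
    · rw [← mem_pow_smul_iff, ← SModEq.zero]; exact hx n
    · obtain ⟨L, hL⟩ := h2 f (fun m n hmn => by
        rw [← mem_pow_smul_iff, ← SModEq.sub_mem]; exact hf hmn)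
      exact ⟨L, fun n => by rw [SModEq.sub_mem, mem_pow_smul_iff]; exact hL n⟩

/-- The `p`-adic completion of a ring. -/
abbrev Hat (p : ℕ) (A : Type u) [CommRing A] : Type u :=
  AdicCompletion (Ideal.span {(p : A)}) A

variable {p : ℕ} {R : Type u} [CommRing R] {A B T : Type u} [CommRing A] [CommRing B] [CommRing T]
  [Algebra R A] [Algebra R B] [Algebra R T]

variable (p R A) in
/-- The canonical map to the `p`-adic completion. -/
def Hat.of : A →ₐ[R] Hat p A where
  toRingHom := algebraMap A (Hat p A)
  commutes' r := by
    apply AdicCompletion.ext_evalₐ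
    intro n
    simp [AdicCompletion.algebraMap_apply]

lemma Hat.mem_smul_iff (n : ℕ) (x : Hat p A) :
    x ∈ (Ideal.span {(p : A)} ^ n • ⊤ : Submodule A (Hat p A)) ↔ (p : Hat p A) ^ n ∣ x := by
  rw [Ideal.span_singleton_pow, Submodule.ideal_span_singleton_smul,
    Submodule.mem_smul_pointwise_iff_exists]
  have h : ∀ y : Hat p A, ((p : A) ^ n) • y = (p : Hat p A) ^ n * y := fun y => by
    rw [← Nat.cast_pow, Nat.cast_smul_eq_nsmul, nsmul_eq_mul, Nat.cast_pow]
  constructor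
  · rintro ⟨y, -, rfl⟩; exact ⟨y, h y⟩
  · rintro ⟨y, rfl⟩; exact ⟨y, trivial, h y⟩

lemma Hat.eval_eq_zero_iff (n : ℕ) (x : Hat p A) :
    AdicCompletion.eval (Ideal.span {(p : A)}) A n x = 0 ↔ (p : Hat p A) ^ n ∣ x := by
  rw [← Hat.mem_smul_iff, AdicCompletion.pow_smul_top_eq_ker_eval (Submodule.fg_span_singleton _),
    LinearMap.mem_ker]

lemma Hat.exists_eq (n : ℕ) (x : Hat p A) : ∃ a y, x = Hat.of p R A a + (p : Hat p A) ^ n * y := by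
  obtain ⟨a, ha⟩ := Submodule.Quotient.mk_surjective _
    (AdicCompletion.eval (Ideal.span {(p : A)}) A n x)
  have h : AdicCompletion.eval (Ideal.span {(p : A)}) A n (x - Hat.of p R A a) = 0 := by
    rw [map_sub, ← ha, sub_eq_zero]; rfl
  obtain ⟨y, hy⟩ := (Hat.eval_eq_zero_iff n _).1 h
  exact ⟨a, y, by rw [← hy]; ring⟩

lemma Hat.evalₐ_eq {m n : ℕ} (h : m ≤ n) (a : A) (y : Hat p A) :
    AdicCompletion.evalₐ (Ideal.span {(p : A)}) m (Hat.of p R A a + (p : Hat p A) ^ n * y) =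
      Ideal.Quotient.mk _ a := by
  have h1 : AdicCompletion.evalₐ (Ideal.span {(p : A)}) m (Hat.of p R A a) =
      Ideal.Quotient.mk _ a := AdicCompletion.evalₐ_of _ _ _
  have h2 : (p : A ⧸ Ideal.span {(p : A)} ^ m) ^ n = 0 := by
    rw [← map_natCast (Ideal.Quotient.mk (Ideal.span {(p : A)} ^ m)), ← map_pow,
      Ideal.Quotient.eq_zero_iff_mem]
    exact Ideal.pow_le_pow_right h (Ideal.pow_mem_pow (Ideal.mem_span_singleton_self _) n)
  rw [map_add, h1, map_mul, map_pow, map_natCast, h2, zero_mul, add_zero]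

instance Hat.isAdicComplete : IsAdicComplete (Ideal.span {(p : Hat p A)}) (Hat p A) := by
  have h := AdicCompletion.isAdicComplete (I := Ideal.span {(p : A)}) (M := A)
    (Submodule.fg_span_singleton _)
  rw [isAdicComplete_iff]
  refine ⟨fun x hx => h.toIsHausdorff.haus x fun n => ?_, fun f hf => ?_⟩
  · rw [SModEq.zero, Hat.mem_smul_iff]; exact hx n
  · obtain ⟨L, hL⟩ := h.toIsPrecomplete.prec (f := f) (fun {m n} hmn => by
      rw [SModEq.sub_mem, Hat.mem_smul_iff]; exact hf m n hmn)
    exact ⟨L, fun n => by rw [← Hat.mem_smul_iff, ← SModEq.sub_mem]; exact hL n⟩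

/-- The maps `Â → A / p^n → T / p^n` induced by `f : A → T`. -/
def Hat.level (f : A →ₐ[R] T) (n : ℕ) : Hat p A →ₐ[R] T ⧸ Ideal.span {(p : T)} ^ n :=
  (Ideal.quotientMapₐ (Ideal.span {(p : T)} ^ n) f (by
    rw [Ideal.span_singleton_pow, Ideal.span_singleton_pow, Ideal.span_singleton_le_iff_mem,
      Ideal.mem_comap, Ideal.mem_span_singleton]; simp)).comp
    ((AdicCompletion.evalₐ (Ideal.span {(p : A)}) n).restrictScalars R)

lemma Hat.level_compat (f : A →ₐ[R] T) {m n : ℕ} (hmn : m ≤ n) :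
    (Ideal.Quotient.factorₐ R (Ideal.pow_le_pow_right hmn)).comp (Hat.level (p := p) f n) =
      Hat.level f m := by
  ext x
  obtain ⟨a, y, rfl⟩ := Hat.exists_eq (R := R) n x
  simp only [Hat.level, AlgHom.comp_apply, AlgHom.restrictScalars_apply, Hat.evalₐ_eq hmn,
    Hat.evalₐ_eq le_rfl]
  rfl

/-- The extension of an algebra homomorphism into a `p`-adically complete ring to the `p`-adic
completion. -/
def Hat.lift [IsAdicComplete (Ideal.span {(p : T)}) T] (f : A →ₐ[R] T) : Hat p A →ₐ[R] T :=
  IsAdicComplete.liftAlgHom (Ideal.span {(p : T)}) (Hat.level f) (Hat.level_compat f)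

lemma Hat.lift_of [IsAdicComplete (Ideal.span {(p : T)}) T] (f : A →ₐ[R] T) (a : A) :
    Hat.lift (p := p) f (Hat.of p R A a) = f a := by
  rw [← sub_eq_zero]
  refine ((isAdicComplete_iff p T).1 inferInstance).1 _ fun n => ?_
  rw [← Ideal.mem_span_singleton, ← Ideal.span_singleton_pow, ← Ideal.Quotient.eq]
  refine (IsAdicComplete.mk_liftAlgHom (Ideal.span {(p : T)}) (Hat.level f) (Hat.level_compat f) n
    _).trans ?_
  rfl

lemma Hat.hom_ext [IsAdicComplete (Ideal.span {(p : T)}) T] {f g : Hat p A →ₐ[R] T}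
    (h : ∀ a, f (Hat.of p R A a) = g (Hat.of p R A a)) : f = g := by
  ext x
  rw [← sub_eq_zero]
  refine ((isAdicComplete_iff p T).1 inferInstance).1 _ fun n => ?_
  obtain ⟨a, y, rfl⟩ := Hat.exists_eq (R := R) n x
  simp [h, ← mul_sub]

variable (p) in
/-- Functoriality of the `p`-adic completion. -/
def Hat.map (f : A →ₐ[R] B) : Hat p A →ₐ[R] Hat p B := Hat.lift ((Hat.of p R B).comp f)

lemma Hat.map_of (f : A →ₐ[R] B) (a : A) : Hat.map p f (Hat.of p R A a) = Hat.of p R B (f a) :=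
  Hat.lift_of _ _

/-- If `R'` is finite free over `R`, then `R' ⊗ T` is `p`-adically complete when `T` is. -/
instance tensor_isAdicComplete {R' : Type u} [CommRing R'] [Algebra R R'] [Module.Free R R']
    [Module.Finite R R'] [hT : IsAdicComplete (Ideal.span {(p : T)}) T] :
    IsAdicComplete (Ideal.span {(p : R' ⊗[R] T)}) (R' ⊗[R] T) := by
  classical
  rw [isAdicComplete_iff] at hT ⊢
  let b := Module.Free.chooseBasis R R'
  let e : R' ⊗[R] T ≃ₗ[R] (Module.Free.ChooseBasisIndex R R' →₀ T) :=
    TensorProduct.equivFinsuppOfBasisLeft b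
  have hdvd : ∀ (n : ℕ) (x : R' ⊗[R] T), (p : R' ⊗[R] T) ^ n ∣ x ↔ ∀ i, (p : T) ^ n ∣ e x i := by
    intro n x
    have h1 : ∀ y : R' ⊗[R] T, (p : R' ⊗[R] T) ^ n * y = (p ^ n : ℕ) • y := fun y => by
      rw [nsmul_eq_mul, Nat.cast_pow]
    have h2 : ∀ y : T, (p : T) ^ n * y = (p ^ n : ℕ) • y := fun y => by
      rw [nsmul_eq_mul, Nat.cast_pow]
    constructor
    · rintro ⟨y, rfl⟩ i
      exact ⟨e y i, by rw [h1, h2, map_nsmul, Finsupp.smul_apply]⟩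
    · intro h
      choose y hy using h
      refine ⟨e.symm (Finsupp.equivFunOnFinite.symm y), ?_⟩
      rw [h1, ← map_nsmul, LinearEquiv.eq_symm_apply]
      ext i
      rw [hy, h2]; rfl
  refine ⟨fun x hx => ?_, fun f hf => ?_⟩
  · rw [← e.map_eq_zero_iff]
    ext i
    exact hT.1 _ fun n => (hdvd n x).1 (hx n) i
  · have : ∀ i, ∃ L, ∀ n, (p : T) ^ n ∣ e (f n) i - L := fun i =>
      hT.2 _ fun m n hmn => by simpa using (hdvd m _).1 (hf m n hmn) i
    choose L hL using this
    refine ⟨e.symm (Finsupp.equivFunOnFinite.symm L), fun n => (hdvd n _).2 fun i => ?_⟩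
    simpa using hL i n

end completion

end

section

section affine
variable {p : ℕ} [Fact p.Prime] {R : Type u} [CommRing R] {D : DeltaBase p R}
variable {R' : Type u} [CommRing R'] [Algebra R R'] {D' : DeltaBase p R'} (hD : D.IsExt D')
variable (A : Type u) [CommRing A] [Algebra R A] {B : Type u} [CommRing B] [Algebra R B]

/-- The morphism of prolongation sequences `(R' ⊗ A)^* → R' ⊗ A^*` over `(R', δ_ϖ)` given by the
universal property; the source is formed with respect to `δ_ϖ` and the target with respect to
`δ_p`. -/
def jetBaseChange :
    (jetProlongation D' (R' ⊗[R] A)).Hom (tensorProlongation hD (jetProlongation D A)) :=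
  Jet.lift (tensorProlongation hD (jetProlongation D A))
    (Algebra.TensorProduct.map (AlgHom.id R' R') (Jet.zeroEquiv D A).toAlgHom)

/-- The `p`-adic completion `Ĵ → R' ⊗ Â` of an algebra homomorphism `J → R' ⊗ A`. -/
def Hat.liftTensor (p : ℕ) [Module.Free R R'] [Module.Finite R R'] {A J : Type u} [CommRing A]
    [Algebra R A] [CommRing J] [Algebra R' J] (f : J →ₐ[R'] R' ⊗[R] A) :
    Hat p J →ₐ[R'] R' ⊗[R] Hat p A :=
  Hat.lift ((Algebra.TensorProduct.map (AlgHom.id R' R') (Hat.of p R A)).comp f)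

lemma Hat.liftTensor_naturality (p : ℕ) [Module.Free R R'] [Module.Finite R R'] {A J B K : Type u}
    [CommRing A] [Algebra R A] [CommRing J] [Algebra R' J] [CommRing B] [Algebra R B] [CommRing K]
    [Algebra R' K] (f : J →ₐ[R'] R' ⊗[R] A) (g : K →ₐ[R'] R' ⊗[R] B) (v : A →ₐ[R] B)
    (w : J →ₐ[R'] K)
    (h : ∀ x, g (w x) = Algebra.TensorProduct.map (AlgHom.id R' R') v (f x)) (y : Hat p J) :
    Hat.liftTensor p g (Hat.map p w y) =
      Algebra.TensorProduct.map (AlgHom.id R' R') (Hat.map p v) (Hat.liftTensor p f y) := by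
  suffices (Hat.liftTensor p g).comp (Hat.map p w) =
      (Algebra.TensorProduct.map (AlgHom.id R' R') (Hat.map p v)).comp (Hat.liftTensor p f) from
    congrArg (fun k => k y) this
  refine Hat.hom_ext fun a => ?_
  simp only [AlgHom.comp_apply, Hat.map_of, Hat.liftTensor, Hat.lift_of, h]
  change ((Algebra.TensorProduct.map (AlgHom.id R' R') (Hat.of p R B)).comp
    (Algebra.TensorProduct.map (AlgHom.id R' R') v)) _ =
    ((Algebra.TensorProduct.map (AlgHom.id R' R') (Hat.map p v)).comp
    (Algebra.TensorProduct.map (AlgHom.id R' R') (Hat.of p R A))) _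
  rw [← Algebra.TensorProduct.map_comp, ← Algebra.TensorProduct.map_comp]
  rw [show (Hat.of p R B).comp v = (Hat.map p v).comp (Hat.of p R A) from
    AlgHom.ext fun x => (Hat.map_of _ _).symm]

/-- The map `𝒪(J^n_ϖ(Spec (R' ⊗ A))) → R' ⊗ 𝒪(J^n_p(Spec A))`, the `p`-adic completion of
`jetBaseChange`. -/
def hatJetBaseChange [Module.Free R R'] [Module.Finite R R'] (n : ℕ) :
    Hat p (Jet D' (R' ⊗[R] A) n) →ₐ[R'] R' ⊗[R] Hat p (Jet D A n) :=
  Hat.liftTensor p ((jetBaseChange hD A).app n)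

variable {A}

lemma Hat.map_comp {E : Type u} [CommRing E] [Algebra R E] (w : B →ₐ[R] E) (v : A →ₐ[R] B) :
    Hat.map p (w.comp v) = (Hat.map p w).comp (Hat.map p v) :=
  Hat.hom_ext fun a => by simp only [AlgHom.comp_apply, Hat.map_of]

lemma jetBaseChange_naturality (v : A →ₐ[R] B) :
    (jetBaseChange hD B).comp (Jet.mapHom D' (Algebra.TensorProduct.map (AlgHom.id R' R') v)) =
      (tensorHom hD (Jet.mapHom D v)).comp (jetBaseChange hD A) := by
  refine Jet.hom_ext _ _ fun a => ?_
  change ((Algebra.TensorProduct.map (AlgHom.id R' R') (Jet.zeroEquiv D B).toAlgHom).comp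
      (Algebra.TensorProduct.map (AlgHom.id R' R') v)) a =
    ((Algebra.TensorProduct.map (AlgHom.id R' R') (Jet.map D v 0)).comp
      (Algebra.TensorProduct.map (AlgHom.id R' R') (Jet.zeroEquiv D A).toAlgHom)) a
  rw [← Algebra.TensorProduct.map_comp, ← Algebra.TensorProduct.map_comp]
  rfl

lemma hatJetBaseChange_naturality [Module.Free R R'] [Module.Finite R R'] (v : A →ₐ[R] B) (n : ℕ)
    (y : Hat p (Jet D' (R' ⊗[R] A) n)) :
    hatJetBaseChange hD B n
      (Hat.map p (Jet.map D' (Algebra.TensorProduct.map (AlgHom.id R' R') v) n) y) =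
    Algebra.TensorProduct.map (AlgHom.id R' R') (Hat.map p (Jet.map D v n))
      (hatJetBaseChange hD A n y) :=
  Hat.liftTensor_naturality p ((jetBaseChange hD A).app n) ((jetBaseChange hD B).app n)
    (Jet.map D v n) (Jet.map D' (Algebra.TensorProduct.map (AlgHom.id R' R') v) n)
    (fun x => congrArg (fun k => Prolongation.Hom.app k n x) (jetBaseChange_naturality hD v)) y

end affine

end

section

open AlgebraicGeometry CategoryTheory CategoryTheory.Limits

section scheme
variable {R : Type u} [CommRing R] {X : Scheme.{u}} (s : X ⟶ Spec (CommRingCat.of R))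

/-- The ring `Γ(X, U)`, with the `R`-algebra structure given by `s : X ⟶ Spec R`. -/
def Sec (_s : X ⟶ Spec (CommRingCat.of R)) (U : X.Opens) : Type u := Γ(X, U)

instance (U : X.Opens) : CommRing (Sec s U) := inferInstanceAs (CommRing Γ(X, U))

lemma le_preimage_top {X Y : Scheme.{u}} (f : X ⟶ Y) (U : X.Opens) : U ≤ f ⁻¹ᵁ ⊤ := fun _ _ => trivial

lemma appTop_eq_appLE {X Y : Scheme.{u}} (f : X ⟶ Y) :
    f.appTop = f.appLE ⊤ ⊤ (le_preimage_top f ⊤) := Scheme.Hom.app_eq_appLE f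

/-- The structure homomorphism `R → Γ(X, U)`. -/
def Sec.structureMap (U : X.Opens) : CommRingCat.of R ⟶ Γ(X, U) :=
  (Scheme.ΓSpecIso (CommRingCat.of R)).inv ≫ s.appLE ⊤ U (le_preimage_top s U)

instance (U : X.Opens) : Algebra R (Sec s U) := (Sec.structureMap s U).hom.toAlgebra

lemma Sec.structureMap_map {U V : X.Opens} (h : U ≤ V) :
    Sec.structureMap s V ≫ X.presheaf.map (homOfLE h).op = Sec.structureMap s U := by
  rw [Sec.structureMap, Sec.structureMap, Category.assoc, Scheme.Hom.appLE_map]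

/-- The restriction map `Γ(X, V) → Γ(X, U)` for `U ≤ V`. -/
def Sec.res {U V : X.Opens} (h : U ≤ V) : Sec s V →ₐ[R] Sec s U where
  toRingHom := (X.presheaf.map (homOfLE h).op).hom
  commutes' r := congrArg (fun k => k.hom r) (Sec.structureMap_map s h)

variable {p : ℕ} (D : DeltaBase p R)

/-- The ring of global functions on the `n`-th jet space of `X`. The jet space of `X` is glued from
the formal schemes `Spf` of the `p`-adic completions of `Γ(X, U)^n`, for `U` affine open in `X`, so a
global function is a family of elements of these completions that is compatible with
restriction. -/
def jetFunctions (n : ℕ) : Subalgebra R ((U : X.affineOpens) → Hat p (Jet D (Sec s U.1) n)) where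
  carrier := {g | ∀ (U V : X.affineOpens) (h : U.1 ≤ V.1),
    Hat.map p (Jet.map D (Sec.res s h) n) (g V) = g U}
  mul_mem' {a b} ha hb U V h := by rw [Pi.mul_apply, map_mul, ha U V h, hb U V h]; rfl
  add_mem' {a b} ha hb U V h := by rw [Pi.add_apply, map_add, ha U V h, hb U V h]; rfl
  algebraMap_mem' r U V h := AlgHom.commutes _ r

/-- `𝒪(J^n(X))`. -/
abbrev JetFun (n : ℕ) : Type u := jetFunctions s D n

/-- Restriction of a function on `J^n(X)` to `J^n(U)`. -/
def JetFun.restrict (n : ℕ) (U : X.affineOpens) : JetFun s D n →ₐ[R] Hat p (Jet D (Sec s U.1) n) :=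
  (Pi.evalAlgHom R _ U).comp (jetFunctions s D n).val

end scheme

section baseChange
variable {R : Type u} [CommRing R] {X : Scheme.{u}} (s : X ⟶ Spec (CommRingCat.of R))
variable (R' : Type u) [CommRing R'] [Algebra R R']

/-- The base change `X_{R'} = X ×_R Spec R'`. -/
abbrev baseChange : Scheme.{u} :=
  pullback s (Spec.map (CommRingCat.ofHom (algebraMap R R')))

/-- The projection `X_{R'} → X`. -/
abbrev baseChangeFst : baseChange s R' ⟶ X := pullback.fst _ _

/-- The structure morphism `X_{R'} → Spec R'`. -/
abbrev baseChangeSnd : baseChange s R' ⟶ Spec (CommRingCat.of R') := pullback.snd _ _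

instance : IsAffineHom (baseChangeFst s R') :=
  MorphismProperty.IsStableUnderBaseChange.of_isPullback (P := @IsAffineHom)
    (IsPullback.of_hasPullback _ _).flip inferInstance

/-- The preimage `U_{R'}` in `X_{R'}` of an affine open `U` of `X`. -/
def affinePreimage (U : X.affineOpens) : (baseChange s R').affineOpens :=
  ⟨baseChangeFst s R' ⁻¹ᵁ U.1, IsAffineOpen.preimage U.2 (baseChangeFst s R')⟩

lemma affinePreimage_mono {U V : X.affineOpens} (h : U.1 ≤ V.1) :
    (affinePreimage s R' U).1 ≤ (affinePreimage s R' V).1 := fun _ hx => h hx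

lemma fromSpec_comp {U : X.Opens} (hU : IsAffineOpen U) :
    hU.fromSpec ≫ s = Spec.map (Sec.structureMap s U) := by
  have h := IsAffineOpen.SpecMap_appLE_fromSpec s (isAffineOpen_top _) hU (le_preimage_top s U)
  rw [IsAffineOpen.fromSpec_top] at h
  rw [← h, Sec.structureMap, Spec.map_comp, Scheme.isoSpec_Spec_inv]

/-- The map `Γ(X, U) → R' ⊗ Γ(X, U)`, as a morphism of commutative rings. -/
def Sec.includeRight (U : X.Opens) : Γ(X, U) ⟶ CommRingCat.of (R' ⊗[R] Sec s U) :=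
  CommRingCat.ofHom (R := Γ(X, U)) (Algebra.TensorProduct.includeRight :
    Sec s U →ₐ[R] R' ⊗[R] Sec s U).toRingHom

/-- The map `R' → R' ⊗ Γ(X, U)`, as a morphism of commutative rings. -/
def Sec.includeLeft (U : X.Opens) : CommRingCat.of R' ⟶ CommRingCat.of (R' ⊗[R] Sec s U) :=
  CommRingCat.ofHom (algebraMap R' (R' ⊗[R] Sec s U))

lemma Sec.include_comp (U : X.Opens) : Sec.structureMap s U ≫ Sec.includeRight s R' U =
    CommRingCat.ofHom (algebraMap R R') ≫ Sec.includeLeft s R' U := by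
  refine CommRingCat.hom_ext (RingHom.ext fun r => ?_)
  have h1 : (Algebra.TensorProduct.includeRight : Sec s U →ₐ[R] R' ⊗[R] Sec s U)
    (algebraMap R (Sec s U) r) = algebraMap R _ r := AlgHom.commutes _ _
  have h2 := IsScalarTower.algebraMap_apply R R' (R' ⊗[R] Sec s U) r
  exact h1.trans h2

/-- The map `R' ⊗ Γ(X, V) → R' ⊗ Γ(X, U)` for `U ≤ V`, as a morphism of commutative rings. -/
def Sec.tensorRes {U V : X.Opens} (h : U ≤ V) :
    CommRingCat.of (R' ⊗[R] Sec s V) ⟶ CommRingCat.of (R' ⊗[R] Sec s U) :=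
  CommRingCat.ofHom (Algebra.TensorProduct.map (AlgHom.id R' R') (Sec.res s h)).toRingHom

lemma Sec.includeRight_tensorRes {U V : X.Opens} (h : U ≤ V) :
    Sec.includeRight s R' V ≫ Sec.tensorRes s R' h =
      X.presheaf.map (homOfLE h).op ≫ Sec.includeRight s R' U := by
  refine CommRingCat.hom_ext (RingHom.ext fun x => ?_)
  exact (Algebra.TensorProduct.map_tmul ..).trans (by rw [map_one]; rfl)

lemma Sec.includeLeft_tensorRes {U V : X.Opens} (h : U ≤ V) :
    Sec.includeLeft s R' V ≫ Sec.tensorRes s R' h = Sec.includeLeft s R' U := by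
  refine CommRingCat.hom_ext (RingHom.ext fun x => ?_)
  exact AlgHom.commutes (Algebra.TensorProduct.map (AlgHom.id R' R') (Sec.res s h)) x

/-- The morphism `Spec (R' ⊗ Γ(X, U)) → X_{R'}` for `U` affine, which identifies the source with
`U_{R'}`. -/
def specToBaseChange {U : X.Opens} (hU : IsAffineOpen U) :
    Spec (CommRingCat.of (R' ⊗[R] Sec s U)) ⟶ baseChange s R' :=
  pullback.lift (Spec.map (Sec.includeRight s R' U) ≫ hU.fromSpec)
    (Spec.map (Sec.includeLeft s R' U)) (by
      rw [Category.assoc, fromSpec_comp, ← Spec.map_comp, ← Spec.map_comp, Sec.include_comp])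

lemma le_preimage {U : X.Opens} (hU : IsAffineOpen U) :
    (⊤ : (Spec (CommRingCat.of (R' ⊗[R] Sec s U))).Opens) ≤
      specToBaseChange s R' hU ⁻¹ᵁ (baseChangeFst s R' ⁻¹ᵁ U) := by
  rw [← Scheme.Hom.comp_preimage, specToBaseChange, pullback.lift_fst, Scheme.Hom.comp_preimage,
    IsAffineOpen.fromSpec_preimage_self]
  exact le_rfl

/-- The canonical ring homomorphism `Γ(X_{R'}, U_{R'}) → R' ⊗ Γ(X, U)`. -/
def secBaseChangeHom {U : X.Opens} (hU : IsAffineOpen U) :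
    Γ(baseChange s R', baseChangeFst s R' ⁻¹ᵁ U) ⟶ CommRingCat.of (R' ⊗[R] Sec s U) :=
  (specToBaseChange s R' hU).appLE (baseChangeFst s R' ⁻¹ᵁ U) ⊤ (le_preimage s R' hU) ≫
    (Scheme.ΓSpecIso (CommRingCat.of (R' ⊗[R] Sec s U))).hom

lemma structureMap_secBaseChangeHom {U : X.Opens} (hU : IsAffineOpen U) :
    Sec.structureMap (baseChangeSnd s R') (baseChangeFst s R' ⁻¹ᵁ U) ≫ secBaseChangeHom s R' hU =
      Sec.includeLeft s R' U := by
  rw [Sec.structureMap, secBaseChangeHom, Category.assoc, Scheme.Hom.appLE_comp_appLE_assoc]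
  have h : specToBaseChange s R' hU ≫ baseChangeSnd s R' = Spec.map (Sec.includeLeft s R' U) :=
    pullback.lift_snd _ _ _
  have h2 : (specToBaseChange s R' hU ≫ baseChangeSnd s R').appLE ⊤ ⊤ (le_preimage_top _ ⊤) =
      (Spec.map (Sec.includeLeft s R' U)).appTop := by
    rw [appTop_eq_appLE]; simp only [h]
  rw [h2, ← Category.assoc, ← Scheme.ΓSpecIso_inv_naturality, Category.assoc, Iso.inv_hom_id,
    Category.comp_id]

lemma specToBaseChange_naturality {U V : X.Opens} (hU : IsAffineOpen U) (hV : IsAffineOpen V)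
    (h : U ≤ V) : Spec.map (Sec.tensorRes s R' h) ≫ specToBaseChange s R' hV =
      specToBaseChange s R' hU := by
  apply pullback.hom_ext
  · rw [Category.assoc, specToBaseChange, specToBaseChange, pullback.lift_fst, pullback.lift_fst,
      ← Category.assoc, ← Spec.map_comp, Sec.includeRight_tensorRes, Spec.map_comp, Category.assoc,
      IsAffineOpen.map_fromSpec]
  · rw [Category.assoc, specToBaseChange, specToBaseChange, pullback.lift_snd, pullback.lift_snd,
      ← Spec.map_comp, Sec.includeLeft_tensorRes]

lemma secBaseChangeHom_naturality {U V : X.Opens} (hU : IsAffineOpen U) (hV : IsAffineOpen V)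
    (h : U ≤ V) (h' : baseChangeFst s R' ⁻¹ᵁ U ≤ baseChangeFst s R' ⁻¹ᵁ V) :
    (baseChange s R').presheaf.map (homOfLE h').op ≫ secBaseChangeHom s R' hU =
      secBaseChangeHom s R' hV ≫ Sec.tensorRes s R' h := by
  rw [secBaseChangeHom, secBaseChangeHom, Category.assoc, ← Scheme.ΓSpecIso_naturality,
    Scheme.Hom.map_appLE_assoc, appTop_eq_appLE,
    Scheme.Hom.appLE_comp_appLE_assoc]
  congr 1
  have := specToBaseChange_naturality s R' hU hV h
  simp only [this]

/-- The canonical `R'`-algebra homomorphism `Γ(X_{R'}, U_{R'}) → R' ⊗ Γ(X, U)`. -/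
def secBaseChange (U : X.affineOpens) :
    Sec (baseChangeSnd s R') (affinePreimage s R' U).1 →ₐ[R'] R' ⊗[R] Sec s U.1 where
  toRingHom := (secBaseChangeHom s R' U.2).hom
  commutes' r := congrArg (fun k => k.hom r) (structureMap_secBaseChangeHom s R' U.2)

lemma secBaseChange_naturality {U V : X.affineOpens} (h : U.1 ≤ V.1) :
    (secBaseChange s R' U).comp (Sec.res (baseChangeSnd s R') (affinePreimage_mono s R' h)) =
    (Algebra.TensorProduct.map (AlgHom.id R' R') (Sec.res s h)).comp (secBaseChange s R' V) :=
  AlgHom.ext fun x => congrArg (fun k => k.hom x)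
    (secBaseChangeHom_naturality s R' U.2 V.2 h (affinePreimage_mono s R' h))

end baseChange

end

section

open AlgebraicGeometry CategoryTheory CategoryTheory.Limits

section global
variable {p : ℕ} [Fact p.Prime] {R : Type u} [CommRing R] {D : DeltaBase p R}
variable {R' : Type u} [CommRing R'] [Algebra R R'] {D' : DeltaBase p R'} (hD : D.IsExt D')
variable [Module.Free R R'] [Module.Finite R R']
variable {X : Scheme.{u}} (s : X ⟶ Spec (CommRingCat.of R)) (n : ℕ)

/-- The map `𝒪(J^n_ϖ(U_{R'})) → R' ⊗ 𝒪(J^n_p(U))` for an affine open `U` of `X`. -/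
def localInclusion (U : X.affineOpens) :
    Hat p (Jet D' (Sec (baseChangeSnd s R') (affinePreimage s R' U).1) n) →ₐ[R']
      R' ⊗[R] Hat p (Jet D (Sec s U.1) n) :=
  (hatJetBaseChange hD (Sec s U.1) n).comp (Hat.map p (Jet.map D' (secBaseChange s R' U) n))

lemma localInclusion_naturality {U V : X.affineOpens} (h : U.1 ≤ V.1)
    (x : Hat p (Jet D' (Sec (baseChangeSnd s R') (affinePreimage s R' V).1) n)) :
    localInclusion hD s n U (Hat.map p (Jet.map D'
      (Sec.res (baseChangeSnd s R') (affinePreimage_mono s R' h)) n) x) =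
    Algebra.TensorProduct.map (AlgHom.id R' R') (Hat.map p (Jet.map D (Sec.res s h) n))
      (localInclusion hD s n V x) := by
  have e : (Hat.map p (Jet.map D' (secBaseChange s R' U) n)).comp (Hat.map p (Jet.map D'
        (Sec.res (baseChangeSnd s R') (affinePreimage_mono s R' h)) n)) =
      (Hat.map p (Jet.map D' (Algebra.TensorProduct.map (AlgHom.id R' R') (Sec.res s h)) n)).comp
        (Hat.map p (Jet.map D' (secBaseChange s R' V) n)) := by
    rw [← Hat.map_comp, ← Hat.map_comp, ← Jet.map_comp, ← Jet.map_comp,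
      secBaseChange_naturality s R' h]
  have e' := congrArg (fun k => hatJetBaseChange hD (Sec s U.1) n (k x)) e
  exact e'.trans (hatJetBaseChange_naturality hD (Sec.res s h) n _)

variable (R' D) in
/-- Restriction `R' ⊗ 𝒪(J^n_p(X)) → ∏_U R' ⊗ 𝒪(J^n_p(U))` to the affine opens. -/
def tensorRestrict : R' ⊗[R] JetFun s D n →ₐ[R']
    ((U : X.affineOpens) → R' ⊗[R] Hat p (Jet D (Sec s U.1) n)) :=
  AlgHom.pi (R := R') fun U =>
    Algebra.TensorProduct.map (AlgHom.id R' R') (JetFun.restrict s D n U)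

/-- The coordinates of an element of `R' ⊗ M` with respect to a basis of `R'` over `R`. -/
def coord {M : Type u} [AddCommGroup M] [Module R M] (i : Module.Free.ChooseBasisIndex R R') :
    R' ⊗[R] M →ₗ[R] M :=
  (TensorProduct.lid R M).toLinearMap ∘ₗ
    LinearMap.rTensor M ((Module.Free.chooseBasis R R').coord i)

lemma coord_tmul {M : Type u} [AddCommGroup M] [Module R M] (i : Module.Free.ChooseBasisIndex R R')
    (r : R') (m : M) : coord i (r ⊗ₜ[R] m) = (Module.Free.chooseBasis R R').repr r i • m := by
  simp [coord]

lemma sum_coord {M : Type u} [AddCommGroup M] [Module R M] (z : R' ⊗[R] M) :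
    ∑ i, (Module.Free.chooseBasis R R' i) ⊗ₜ[R] coord i z = z := by
  induction z with
  | zero => simp
  | add x y hx hy => simp only [map_add, TensorProduct.tmul_add, Finset.sum_add_distrib, hx, hy]
  | tmul r m =>
    simp only [coord_tmul, TensorProduct.tmul_smul, TensorProduct.smul_tmul']
    rw [← TensorProduct.sum_tmul, Module.Basis.sum_repr]

lemma coord_map {A B : Type u} [CommRing A] [Algebra R A] [CommRing B] [Algebra R B]
    (f : A →ₐ[R] B) (i : Module.Free.ChooseBasisIndex R R') (z : R' ⊗[R] A) :
    coord i (Algebra.TensorProduct.map (AlgHom.id R' R') f z) = f (coord i z) := by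
  induction z with
  | zero => simp
  | add x y hx hy => simp only [map_add, hx, hy]
  | tmul r m => simp [coord_tmul]

lemma tensorRestrict_injective : Function.Injective (tensorRestrict D R' s n) := by
  intro x y h
  rw [← sum_coord x, ← sum_coord y]
  refine Finset.sum_congr rfl fun i _ => ?_
  congr 1
  apply Subtype.ext
  funext U
  have h1 : ∀ w, coord i (tensorRestrict D R' s n w U) = (coord i w).1 U := fun w =>
    coord_map (JetFun.restrict s D n U) i w
  rw [← h1, ← h1, h]

/-- An element of `∏_U R' ⊗ 𝒪(J^n_p(U))` that is compatible with restriction comes from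
`R' ⊗ 𝒪(J^n_p(X))`. -/
lemma mem_range_tensorRestrict (z : (U : X.affineOpens) → R' ⊗[R] Hat p (Jet D (Sec s U.1) n))
    (hz : ∀ (U V : X.affineOpens) (h : U.1 ≤ V.1),
      Algebra.TensorProduct.map (AlgHom.id R' R') (Hat.map p (Jet.map D (Sec.res s h) n)) (z V) =
        z U) : z ∈ (tensorRestrict D R' s n).range := by
  let y : Module.Free.ChooseBasisIndex R R' → JetFun s D n := fun i =>
    ⟨fun U => coord i (z U), fun U V h => by rw [← coord_map, hz U V h]⟩
  refine ⟨∑ i, (Module.Free.chooseBasis R R' i) ⊗ₜ[R] y i, ?_⟩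
  funext U
  change tensorRestrict D R' s n (∑ i, (Module.Free.chooseBasis R R' i) ⊗ₜ[R] y i) U = z U
  rw [map_sum, Finset.sum_apply]
  exact sum_coord (z U)

/-- The family, indexed by the affine opens `U` of `X`, of the images of `g|_{U_{R'}}` in
`R' ⊗ 𝒪(J^n_p(U))`. -/
def inclusionFamily : JetFun (baseChangeSnd s R') D' n →ₐ[R']
    ((U : X.affineOpens) → R' ⊗[R] Hat p (Jet D (Sec s U.1) n)) :=
  AlgHom.pi (R := R') fun U =>
    (localInclusion hD s n U).comp
      (JetFun.restrict (baseChangeSnd s R') D' n (affinePreimage s R' U))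

lemma inclusionFamily_mem (g : JetFun (baseChangeSnd s R') D' n) :
    inclusionFamily hD s n g ∈ (tensorRestrict D R' s n).range := by
  apply mem_range_tensorRestrict
  intro U V h
  have := g.2 (affinePreimage s R' U) (affinePreimage s R' V) (affinePreimage_mono s R' h)
  exact (localInclusion_naturality hD s n h _).symm.trans
    (congrArg (localInclusion hD s n U) this)

/-- The canonical homomorphism `𝒪(J^n_ϖ(X_{R'})) → R' ⊗ 𝒪(J^n_p(X))`. -/
def jetInclusion : JetFun (baseChangeSnd s R') D' n →ₐ[R'] R' ⊗[R] JetFun s D n :=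
  (AlgEquiv.ofInjective (tensorRestrict D R' s n)
    (tensorRestrict_injective s n)).symm.toAlgHom.comp
    ((inclusionFamily hD s n).codRestrict _ (inclusionFamily_mem hD s n))

/-- `jetInclusion` restricts, on every affine open `U` of `X`, to `localInclusion`. -/
lemma jetInclusion_restrict (g : JetFun (baseChangeSnd s R') D' n) (U : X.affineOpens) :
    Algebra.TensorProduct.map (AlgHom.id R' R') (JetFun.restrict s D n U) (jetInclusion hD s n g) =
      localInclusion hD s n U (g.1 (affinePreimage s R' U)) := by
  have h : tensorRestrict D R' s n (jetInclusion hD s n g) = inclusionFamily hD s n g :=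
    congrArg Subtype.val ((AlgEquiv.ofInjective (tensorRestrict D R' s n)
      (tensorRestrict_injective s n)).apply_symm_apply _)
  exact congrArg (fun k => k U) h

/-- The map `Tr ⊗ 1 : R' ⊗ M → R ⊗ M = M`. -/
def tensorTrace (R' : Type u) [CommRing R'] [Algebra R R'] (M : Type u) [AddCommGroup M]
    [Module R M] : R' ⊗[R] M →ₗ[R] M :=
  (TensorProduct.lid R M).toLinearMap ∘ₗ LinearMap.rTensor M (Algebra.trace R R')

/-- The arithmetic trace `𝒪(J^n_ϖ(X_{R'})) → 𝒪(J^n_p(X))`. -/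
def arithTrace : JetFun (baseChangeSnd s R') D' n →+ JetFun s D n :=
  (tensorTrace R' (JetFun s D n)).toAddMonoidHom.comp
    (jetInclusion hD s n).toRingHom.toAddMonoidHom

end global

end

section

section rings
open Polynomial

/-- The base `(R, ϖ, δ)` with `δ x = (φ(x) - x^p)/ϖ`, for `ϖ` a regular element dividing `p` and `φ`
a ring endomorphism of `R` with `φ(x) ≡ x^p` modulo `ϖ`. -/
def DeltaBase.ofFrobenius {p : ℕ} [Fact p.Prime] {R : Type u} [CommRing R] (ϖ : R)
    (hϖ : ∀ x, ϖ * x = 0 → x = 0) (hp : ϖ ∣ (p : R)) (φ : R →+* R)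
    (hφ : ∀ x, ϖ ∣ φ x - x ^ p) : DeltaBase p R where
  ϖ := ϖ
  c := hp.choose
  ϖ_mul_c := hp.choose_spec.symm
  δ x := (hφ x).choose
  isPiDer := by
    have hc : ∀ {x y : R}, ϖ * x = ϖ * y → x = y := fun {x y} h =>
      sub_eq_zero.1 (hϖ _ (by rw [mul_sub, h, sub_self]))
    have h := fun x => (hφ x).choose_spec.symm
    refine ⟨hc ?_, fun x y => hc ?_, fun x y => hc ?_⟩
    · rw [h]; simp
    · have h1 := p_mul_Cp p x y
      rw [hp.choose_spec] at h1
      rw [mul_add, mul_add, h, h, h, ← mul_assoc, RingHom.id_apply, RingHom.id_apply, h1, map_add]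
      ring
    · have e : ∀ a b : R, ϖ * (x ^ p * b + y ^ p * a + ϖ * a * b) =
        x ^ p * (ϖ * b) + y ^ p * (ϖ * a) + (ϖ * a) * (ϖ * b) := fun a b => by ring
      rw [RingHom.id_apply, RingHom.id_apply, e, h, h, h, map_mul]
      ring

lemma DeltaBase.ofFrobenius_δ {p : ℕ} [Fact p.Prime] {R : Type u} [CommRing R] (ϖ : R)
    (hϖ : ∀ x, ϖ * x = 0 → x = 0) (hp : ϖ ∣ (p : R)) (φ : R →+* R)
    (hφ : ∀ x, ϖ ∣ φ x - x ^ p) (x : R) :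
    ϖ * (DeltaBase.ofFrobenius ϖ hϖ hp φ hφ).δ x = φ x - x ^ p := (hφ x).choose_spec.symm

variable (p : ℕ) [Fact p.Prime]

/-- `R_p`, the completion of the maximal unramified extension of `ℤ_p`, that is, the ring of Witt
vectors of an algebraic closure of `𝔽_p`. -/
abbrev Rp : Type := WittVector p (AlgebraicClosure (ZMod p))

/-- The embedding `ℤ_p → R_p`. -/
def zpToRp : ℤ_[p] →+* Rp p :=
  (WittVector.map (algebraMap (ZMod p) (AlgebraicClosure (ZMod p)))).comp
    (WittVector.equiv p).symm.toRingHom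

lemma frobenius_zpToRp (x : ℤ_[p]) : WittVector.frobenius (zpToRp p x) = zpToRp p x := by
  apply WittVector.ext
  intro n
  simp only [WittVector.coeff_frobenius_charP, zpToRp, RingHom.comp_apply, WittVector.map_coeff]
  rw [← map_pow, ZMod.pow_card]

lemma p_dvd_frobenius_sub (x : Rp p) : (p : Rp p) ∣ WittVector.frobenius x - x ^ p := by
  rw [← Ideal.mem_span_singleton, ← WittVector.ker_constantCoeff, RingHom.mem_ker, map_sub, map_pow]
  change (WittVector.frobenius x).coeff 0 - x.coeff 0 ^ p = 0
  rw [WittVector.coeff_frobenius_charP, sub_self]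

lemma p_ne_zero_Rp : (p : Rp p) ≠ 0 := (WittVector.irreducible p).ne_zero

/-- `R_p` with the `p`-derivation `δ_p x = (φ(x) - x^p)/p`, `φ` the Frobenius of `R_p`. -/
def pBase : DeltaBase p (Rp p) :=
  DeltaBase.ofFrobenius (p : Rp p)
    (fun _ h => (mul_eq_zero.1 h).resolve_left (p_ne_zero_Rp p)) dvd_rfl
    WittVector.frobenius (p_dvd_frobenius_sub p)

/-- An Eisenstein polynomial of degree `e ≥ 2` with coefficients in `ℤ_p`. -/
structure EisensteinPoly where
  poly : ℤ_[p][X]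
  monic : poly.Monic
  eisenstein : poly.IsEisensteinAt (Ideal.span {(p : ℤ_[p])})
  two_le_natDegree : 2 ≤ poly.natDegree

variable {p} (E : EisensteinPoly p)

lemma EisensteinPoly.irreducible : Irreducible (E.poly.map (algebraMap ℤ_[p] ℚ_[p])) := by
  rw [← Polynomial.Monic.irreducible_iff_irreducible_map_fraction_map E.monic]
  refine E.eisenstein.irreducible ?_ E.monic.isPrimitive (by have := E.two_le_natDegree; omega)
  rw [Ideal.span_singleton_prime (by exact_mod_cast (Fact.out : p.Prime).ne_zero)]
  exact PadicInt.prime_p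

instance : Fact (Irreducible (E.poly.map (algebraMap ℤ_[p] ℚ_[p]))) := ⟨E.irreducible⟩

/-- The field `ℚ_p(π)`, `π` a root of the Eisenstein polynomial. -/
abbrev QpPi : Type := AdjoinRoot (E.poly.map (algebraMap ℤ_[p] ℚ_[p]))

/-- The ring `R_π = R_p[π]`, `π` a root of the Eisenstein polynomial. -/
abbrev Rpi : Type := AdjoinRoot (E.poly.map (zpToRp p))

instance : Module.Free (Rp p) (Rpi E) := (E.monic.map (zpToRp p)).free_adjoinRoot
instance : Module.Finite (Rp p) (Rpi E) := (E.monic.map (zpToRp p)).finite_adjoinRoot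

/-- The element `π` of `R_π`. -/
def piElt : Rpi E := AdjoinRoot.root (E.poly.map (zpToRp p))

/-- The endomorphism `φ` of `R_π` that extends the Frobenius of `R_p` and fixes `π`. -/
def phiRpi : Rpi E →+* Rpi E :=
  AdjoinRoot.lift ((AdjoinRoot.of (E.poly.map (zpToRp p))).comp WittVector.frobenius) (piElt E) (by
    have h : ((AdjoinRoot.of (E.poly.map (zpToRp p))).comp WittVector.frobenius).comp (zpToRp p) =
        (AdjoinRoot.of (E.poly.map (zpToRp p))).comp (zpToRp p) :=
      RingHom.ext fun x => by simp only [RingHom.comp_apply, frobenius_zpToRp]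
    rw [Polynomial.eval₂_map, h, ← Polynomial.eval₂_map]
    exact AdjoinRoot.eval₂_root _)

lemma phiRpi_of (x : Rp p) : phiRpi E (algebraMap (Rp p) (Rpi E) x) =
    algebraMap (Rp p) (Rpi E) (WittVector.frobenius x) := AdjoinRoot.lift_of _

lemma phiRpi_pi : phiRpi E (piElt E) = piElt E := AdjoinRoot.lift_root _

lemma exists_eq_pi_mul_add (x : Rpi E) : ∃ y r, x = piElt E * y + algebraMap (Rp p) (Rpi E) r := by
  obtain ⟨f, rfl⟩ := AdjoinRoot.mk_surjective x
  refine ⟨AdjoinRoot.mk _ f.divX, f.coeff 0, ?_⟩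
  conv_lhs => rw [← Polynomial.X_mul_divX_add f]
  rw [map_add, map_mul, AdjoinRoot.mk_X, AdjoinRoot.mk_C]
  rfl

lemma pi_dvd_p : piElt E ∣ (p : Rpi E) := by
  have h0 : AdjoinRoot.mk (E.poly.map (zpToRp p))
      (X * (E.poly.map (zpToRp p)).divX + C ((E.poly.map (zpToRp p)).coeff 0)) = 0 := by
    rw [Polynomial.X_mul_divX_add]; exact AdjoinRoot.mk_self
  rw [map_add, map_mul, AdjoinRoot.mk_X, AdjoinRoot.mk_C, Polynomial.coeff_map] at h0
  obtain ⟨u, hu⟩ := Ideal.mem_span_singleton.1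
    (E.eisenstein.mem (n := 0) (by have := E.two_le_natDegree; omega))
  have hunit : IsUnit u := by
    by_contra hn
    rw [PadicInt.isUnit_iff] at hn
    have hlt : ‖u‖ < 1 := lt_of_le_of_ne (PadicInt.norm_le_one u) hn
    obtain ⟨w, rfl⟩ := (PadicInt.norm_lt_one_iff_dvd u).1 hlt
    refine E.eisenstein.notMem ?_
    rw [Ideal.span_singleton_pow, Ideal.mem_span_singleton, hu]
    exact ⟨w, by ring⟩
  obtain ⟨v, hv⟩ := hunit.exists_right_inv
  have h1 : (p : ℤ_[p]) = E.poly.coeff 0 * v := by rw [hu, mul_assoc, hv, mul_one]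
  have h2 : (p : Rpi E) = AdjoinRoot.of (E.poly.map (zpToRp p)) (zpToRp p (E.poly.coeff 0)) *
      AdjoinRoot.of (E.poly.map (zpToRp p)) (zpToRp p v) := by
    rw [← map_mul, ← map_mul, ← h1]; simp
  rw [h2, eq_neg_of_add_eq_zero_right h0]
  exact (Dvd.dvd.neg_right (Dvd.intro _ rfl)).mul_right _

lemma pi_dvd_phiRpi_sub (x : Rpi E) : piElt E ∣ phiRpi E x - x ^ p := by
  obtain ⟨y, r, rfl⟩ := exists_eq_pi_mul_add E x
  have h1 : piElt E ∣ (piElt E * y + algebraMap (Rp p) (Rpi E) r) ^ p -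
      (algebraMap (Rp p) (Rpi E) r) ^ p :=
    Dvd.dvd.trans ⟨y, by ring⟩ (sub_dvd_pow_sub_pow _ _ p)
  have h2 : piElt E ∣ algebraMap (Rp p) (Rpi E) (WittVector.frobenius r - r ^ p) := by
    obtain ⟨z, hz⟩ := p_dvd_frobenius_sub p r
    rw [hz, map_mul, map_natCast]
    exact (pi_dvd_p E).mul_right _
  rw [map_sub, map_pow] at h2
  have h3 := dvd_sub (h2.add (Dvd.intro (phiRpi E y) rfl)) h1
  convert h3 using 1
  rw [map_add, map_mul, phiRpi_pi, phiRpi_of]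
  ring

lemma pi_regular (x : Rpi E) (h : piElt E * x = 0) : x = 0 := by
  obtain ⟨c, hc⟩ := pi_dvd_p E
  have h1 : (p : Rp p) • x = 0 := by
    rw [Algebra.smul_def, map_natCast, hc, mul_right_comm, h, zero_mul]
  exact (smul_eq_zero.1 h1).resolve_left (p_ne_zero_Rp p)

/-- `R_π` with the `π`-derivation `δ_π x = (φ(x) - x^p)/π`. -/
def piBase : DeltaBase p (Rpi E) :=
  DeltaBase.ofFrobenius (piElt E) (pi_regular E) (pi_dvd_p E) (phiRpi E) (pi_dvd_phiRpi_sub E)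

lemma isExt : (pBase p).IsExt (piBase E) where
  ϖ_eq := rfl
  c_eq := by
    have h := (pBase p).ϖ_mul_c
    exact mul_left_cancel₀ (p_ne_zero_Rp p) (h.trans (mul_one _).symm)
  δ_algebraMap r := by
    have h1 := DeltaBase.ofFrobenius_δ (piElt E) (pi_regular E) (pi_dvd_p E) (phiRpi E)
      (pi_dvd_phiRpi_sub E) (algebraMap (Rp p) (Rpi E) r)
    have h2 : (p : Rp p) * (pBase p).δ r = WittVector.frobenius r - r ^ p :=
      DeltaBase.ofFrobenius_δ (p : Rp p) _ _ WittVector.frobenius _ r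
    have h3 : piElt E * (piBase E).c = p := (piBase E).ϖ_mul_c
    rw [← sub_eq_zero]
    apply pi_regular E
    rw [mul_sub, ← mul_assoc, h3]
    refine sub_eq_zero.2 (h1.trans ?_)
    rw [phiRpi_of, ← map_pow, ← map_sub, ← h2, map_mul, map_natCast]

end rings

end

end PiJet

end

/-! Write G for the Galois group of ℚ_p(π) over ℚ_p. The content of the theorem is that G acts on
both sides of ι, compatibly with ι; the equivalence then follows from a trace computation.

If σ ∈ G acts R_p-linearly on R_π, it commutes with φ, because φ fixes ℤ_p[π] and σ(π) lies there.
It does not commute with δ_π = (φ(x) - x^p)/π, since the denominator moves: σ(δ_π x) = w δ_π(σ x)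
with w = π/σ(π). This w lies in R_π because every conjugate of π is divisible by π. Hence, for any
prolongation sequence, restricting scalars along σ and replacing δ by w δ gives another prolongation
sequence, and the universal property turns σ-semilinear ring maps into maps of jet algebras
(`Jet.semiMap`). Applied to the automorphism of X_{R_π} over X defined by σ, this yields an action g
↦ σ·g on 𝒪(J^n_π(X_{R_π})) with ι(σ·g) = (σ ⊗ 1) ι(g) (`jetInclusion_twist`).

From 1) to 2): as the trace of R_π over R_p is the sum of the conjugates (`sum_extendRpiEquiv`), ι(∑
σ·g) = ∑ (σ ⊗ 1) ι(g) = 1 ⊗ τ_π(g). So 1 ⊗ τ_π(g) is always in the image of ι, and the same ν works.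

From 2) to 1): if ι(g) = 1 ⊗ h then τ_π(r g) = r e h for r ∈ R_p, and e is a power of p times a unit
of R_p (`exists_mul_trace_one`). This direction needs no Galois action.

The arithmetic input is that ℤ_p[π] is the full ring of integers of ℚ_p(π), by the Eisenstein
property. Therefore G acts on ℤ_p[π], and by extension of scalars on R_π. -/

noncomputable section

namespace PiJet

/-! ### Semilinear functoriality of universal prolongation sequences -/

section twist

variable {p : ℕ} {R : Type u} [CommRing R] {D : DeltaBase p R}

/-- The endomorphism `σ` of `R` is compatible with the base `(R, ϖ, δ)` up to the factor
`w = ϖ / σ(ϖ)`: it transforms `δ` into `w δ`. -/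
structure DeltaBase.IsTwist (D : DeltaBase p R) (σ : R →+* R) (w : R) : Prop where
  map_ϖ_mul : σ D.ϖ * w = D.ϖ
  map_c : σ D.c = w * D.c
  map_δ : ∀ r, σ (D.δ r) = w * D.δ (σ r)

variable {σ : R →+* R} {w : R}

/-- A prolongation sequence `S` with the `R`-algebra structure twisted by `σ` and the
`ϖ`-derivation `w δ`. -/
def Prolongation.twist (hσ : D.IsTwist σ w) (S : Prolongation D) : Prolongation D where
  obj := S.obj
  ring := S.ring
  alg n := ((algebraMap R (S.obj n)).comp σ).toAlgebra
  incl n :=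
    let i : S.obj n →+* S.obj (n + 1) := S.incl n
    -- Stated for the original algebra structures, before the twisted instance enters the scope;
    -- under the twisted structure `commutes'` unfolds to this identity.
    have hi : ∀ r, i (algebraMap R _ (σ r)) = algebraMap R _ (σ r) :=
      fun r => (S.incl n).commutes (σ r)
    letI (m : ℕ) : Algebra R (S.obj m) := ((algebraMap R (S.obj m)).comp σ).toAlgebra
    { i with commutes' := hi }
  δ n x := algebraMap R (S.obj (n + 1)) w * S.δ n x
  isPiDer n := by
    have h := S.isPiDer n
    -- In the twisted algebra `c` and `ϖ` act as σ(c) and σ(ϖ). The factor w in the additive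
    -- correction is absorbed by σ(c) = w c, and σ(ϖ) (w δx)(w δy) = w ϖ δx δy because σ(ϖ) w = ϖ.
    have hc : algebraMap R (S.obj (n + 1)) (σ D.c) =
        algebraMap R _ w * algebraMap R _ D.c := by rw [hσ.map_c, map_mul]
    have hϖ : algebraMap R (S.obj (n + 1)) (σ D.ϖ) * algebraMap R _ w = algebraMap R _ D.ϖ := by
      rw [← map_mul, hσ.map_ϖ_mul]
    refine ⟨by rw [h.map_one, mul_zero], fun x y => ?_, fun x y => ?_⟩
    · change _ = algebraMap R (S.obj (n + 1)) w * S.δ n x +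
        algebraMap R (S.obj (n + 1)) w * S.δ n y +
        algebraMap R (S.obj (n + 1)) (σ D.c) * Cp p (S.incl n x) (S.incl n y)
      rw [h.map_add, hc]
      change algebraMap R (S.obj (n + 1)) w * (S.δ n x + S.δ n y +
        algebraMap R (S.obj (n + 1)) D.c * Cp p (S.incl n x) (S.incl n y)) = _
      ring
    · change _ = S.incl n x ^ p * (algebraMap R (S.obj (n + 1)) w * S.δ n y) +
        S.incl n y ^ p * (algebraMap R (S.obj (n + 1)) w * S.δ n x) +
        algebraMap R (S.obj (n + 1)) (σ D.ϖ) * (algebraMap R (S.obj (n + 1)) w * S.δ n x) *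
          (algebraMap R (S.obj (n + 1)) w * S.δ n y)
      rw [h.map_mul, ← mul_assoc (algebraMap R (S.obj (n + 1)) (σ D.ϖ)), hϖ]
      change algebraMap R (S.obj (n + 1)) w * (S.incl n x ^ p * S.δ n y +
        S.incl n y ^ p * S.δ n x + algebraMap R (S.obj (n + 1)) D.ϖ * S.δ n x * S.δ n y) = _
      ring
  δ_incl n x := by
    change algebraMap R (S.obj (n + 2)) w * S.δ (n + 1) (S.incl n x) =
      S.incl (n + 1) (algebraMap R (S.obj (n + 1)) w * S.δ n x)
    rw [S.δ_incl, map_mul, AlgHom.commutes]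
  δ_algebraMap n r := by
    change algebraMap R (S.obj (n + 1)) w * S.δ n (algebraMap R (S.obj n) (σ r)) =
      algebraMap R (S.obj (n + 1)) (σ (D.δ r))
    rw [S.δ_algebraMap, hσ.map_δ, map_mul]

variable {A B C : Type u} [CommRing A] [CommRing B] [CommRing C] [Algebra R A] [Algebra R B]
  [Algebra R C]

/-- The ring homomorphism `A^n → B^n` induced by a `σ`-semilinear ring homomorphism `A → B`. -/
def Jet.semiMap (hσ : D.IsTwist σ w) (f : A →+* B)
    (hf : ∀ r, f (algebraMap R A r) = algebraMap R B (σ r)) (n : ℕ) :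
    Jet D A n →+* Jet D B n :=
  -- A σ-semilinear map to B is R-linear to the zeroth term of the twisted sequence, so the
  -- universal property of the jets of A applies; the twisted algebra structure is then forgotten.
  letI S := (jetProlongation D B).twist hσ
  ((Jet.lift S ({ f with commutes' := hf } : A →ₐ[R] S.obj 0)).app n : Jet D A n →+* S.obj n)

section
variable (hσ : D.IsTwist σ w) (f : A →+* B)
  (hf : ∀ r, f (algebraMap R A r) = algebraMap R B (σ r))

lemma Jet.semiMap_zero (a : A) :
    Jet.semiMap hσ f hf 0 (Jet.zeroEquiv D A a) = Jet.zeroEquiv D B (f a) := rfl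

lemma Jet.semiMap_incl (n : ℕ) (x : Jet D A n) :
    Jet.semiMap hσ f hf (n + 1) (Jet.incl D A n x) =
      Jet.incl D B n (Jet.semiMap hσ f hf n x) :=
  (Jet.lift ((jetProlongation D B).twist hσ) _).app_incl n x

lemma Jet.semiMap_δ (n : ℕ) (x : Jet D A n) :
    Jet.semiMap hσ f hf (n + 1) (Jet.δ D A n x) =
      algebraMap R _ w * Jet.δ D B n (Jet.semiMap hσ f hf n x) :=
  (Jet.lift ((jetProlongation D B).twist hσ) _).app_δ n x

end

/-- A ring homomorphism from a polynomial ring is determined on constants and variables, with no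
linearity over R. The form `Step.hom_ext` for R-algebra maps does not cover semilinear maps. -/
lemma Step.ringHom_ext {T : Stage R} {C : Type*} [CommRing C] {f g : Step D T →+* C}
    (h1 : ∀ b, f (Step.incl D T b) = g (Step.incl D T b))
    (h2 : ∀ b, f (Step.δ D T b) = g (Step.δ D T b)) : f = g := by
  have : f.comp (Step.mk D T).toRingHom = g.comp (Step.mk D T).toRingHom :=
    MvPolynomial.ringHom_ext h1 h2
  ext x
  obtain ⟨q, rfl⟩ := Ideal.Quotient.mk_surjective x
  exact congrArg (fun k => k q) this

/-- Two compatible families of ring homomorphisms on the universal prolongation sequence of `A`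
agree if they agree on `A` and inductively on the generators. -/
lemma Jet.ringHom_ext {C : ℕ → Type*} [∀ n, CommRing (C n)] {F G : ∀ n, Jet D A n →+* C n}
    (h0 : ∀ a, F 0 (Jet.zeroEquiv D A a) = G 0 (Jet.zeroEquiv D A a))
    (h1 : ∀ n, F n = G n → ∀ x, F (n + 1) (Jet.incl D A n x) = G (n + 1) (Jet.incl D A n x))
    (h2 : ∀ n, F n = G n → ∀ x, F (n + 1) (Jet.δ D A n x) = G (n + 1) (Jet.δ D A n x))
    (n : ℕ) : F n = G n := by
  induction n with
  | zero => ext x; exact h0 x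
  | succ n ih => exact Step.ringHom_ext (h1 n ih) (h2 n ih)

lemma Jet.map_zero (v : A →ₐ[R] B) (a : A) :
    Jet.map D v 0 (Jet.zeroEquiv D A a) = Jet.zeroEquiv D B (v a) := rfl

lemma Jet.map_incl (v : A →ₐ[R] B) (n : ℕ) (x : Jet D A n) :
    Jet.map D v (n + 1) (Jet.incl D A n x) = Jet.incl D B n (Jet.map D v n x) :=
  (Jet.mapHom D v).app_incl n x

lemma Jet.map_δ (v : A →ₐ[R] B) (n : ℕ) (x : Jet D A n) :
    Jet.map D v (n + 1) (Jet.δ D A n x) = Jet.δ D B n (Jet.map D v n x) :=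
  (Jet.mapHom D v).app_δ n x

/-- With `Jet.map_comp_semiMap`, this expresses that the semilinear maps on jets depend only on the
composite A → C in degree 0: both sides respect the structure maps and turn δ into w δ, so they
agree on generators. It allows linear and semilinear maps to be interchanged. -/
lemma Jet.semiMap_comp_map (hσ : D.IsTwist σ w) (f : B →+* C) (hf) (v : A →ₐ[R] B)
    (g : A →+* C) (hg) (h : ∀ a, f (v a) = g a) (n : ℕ) :
    (Jet.semiMap hσ f hf n).comp (Jet.map D v n : Jet D A n →+* Jet D B n) =
      Jet.semiMap hσ g hg n := by
  refine Jet.ringHom_ext (F := fun n => (Jet.semiMap hσ f hf n).comp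
    (Jet.map D v n : Jet D A n →+* Jet D B n)) (G := Jet.semiMap hσ g hg) (fun a => ?_)
    (fun n ih x => ?_) (fun n ih x => ?_) n
  · simp only [RingHom.comp_apply, RingHom.coe_coe, Jet.map_zero, Jet.semiMap_zero, h]
  · simp only [RingHom.comp_apply, RingHom.coe_coe, Jet.map_incl, Jet.semiMap_incl, ← ih]
  · simp only [RingHom.comp_apply, RingHom.coe_coe, Jet.map_δ, Jet.semiMap_δ, ← ih]

lemma Jet.map_comp_semiMap (hσ : D.IsTwist σ w) (f : A →+* B) (hf) (v : B →ₐ[R] C)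
    (g : A →+* C) (hg) (h : ∀ a, v (f a) = g a) (n : ℕ) :
    (Jet.map D v n : Jet D B n →+* Jet D C n).comp (Jet.semiMap hσ f hf n) =
      Jet.semiMap hσ g hg n := by
  refine Jet.ringHom_ext (F := fun n => (Jet.map D v n : Jet D B n →+* Jet D C n).comp
    (Jet.semiMap hσ f hf n)) (G := Jet.semiMap hσ g hg) (fun a => ?_)
    (fun n ih x => ?_) (fun n ih x => ?_) n
  · simp only [RingHom.comp_apply, RingHom.coe_coe, Jet.map_zero, Jet.semiMap_zero, h]
  · simp only [RingHom.comp_apply, RingHom.coe_coe, Jet.map_incl, Jet.semiMap_incl, ← ih]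
  · simp only [RingHom.comp_apply, RingHom.coe_coe, Jet.map_δ, Jet.semiMap_δ, ← ih, map_mul,
      AlgHom.commutes]

end twist

/-! ### The endomorphism σ ⊗ 1 and the base change of jets -/

section tensorTwist

variable {p : ℕ} [Fact p.Prime] {R : Type u} [CommRing R] {D : DeltaBase p R}
variable {R' : Type u} [CommRing R'] [Algebra R R'] {D' : DeltaBase p R'} (hD : D.IsExt D')
variable {σ : R' →ₐ[R] R'} {w : R'}

/-- The endomorphism `σ ⊗ 1` of `R' ⊗ A`. -/
def tensorTwist (σ : R' →ₐ[R] R') (A : Type u) [CommRing A] [Algebra R A] :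
    R' ⊗[R] A →+* R' ⊗[R] A :=
  (Algebra.TensorProduct.map σ (AlgHom.id R A)).toRingHom

section
variable {A B : Type u} [CommRing A] [Algebra R A] [CommRing B] [Algebra R B]

@[simp] lemma tensorTwist_tmul (r : R') (a : A) :
    tensorTwist σ A (r ⊗ₜ a) = σ r ⊗ₜ a := rfl

lemma tensorTwist_algebraMap (r : R') : tensorTwist σ A (algebraMap R' (R' ⊗[R] A) r) =
    algebraMap R' (R' ⊗[R] A) (σ r) := rfl

lemma tensorTwist_map (v : A →ₐ[R] B) (z : R' ⊗[R] A) :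
    tensorTwist σ B (Algebra.TensorProduct.map (AlgHom.id R' R') v z) =
      Algebra.TensorProduct.map (AlgHom.id R' R') v (tensorTwist σ A z) := by
  induction z with
  | zero => simp
  | add x y hx hy => simp only [map_add, hx, hy]
  | tmul r a => simp

end

/-- The identity passes to sums because σ(c) = w c and to products because σ(ϖ) w = ϖ, so it need
only hold on r ⊗ 1 and 1 ⊗ a. On r ⊗ 1 it is the rule for σ(δ r); on 1 ⊗ a, where the derivation is
c ⊗ δ a, it is again σ(c) = w c. -/
lemma tensorTwist_tensorδ (hσ : D'.IsTwist σ w) (S : Prolongation D) (n : ℕ)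
    (z : R' ⊗[R] S.obj n) :
    tensorTwist σ (S.obj (n + 1)) (tensorδ hD S n z) =
      algebraMap R' _ w * tensorδ hD S n (tensorTwist σ (S.obj n) z) := by
  have hi : ∀ z, tensorTwist σ (S.obj (n + 1)) (tensorIncl R' S n z) =
      tensorIncl R' S n (tensorTwist σ (S.obj n) z) := tensorTwist_map (S.incl n)
  have hc : tensorTwist σ (S.obj (n + 1)) (D'.cIn _) = algebraMap R' _ w * D'.cIn _ := by
    rw [DeltaBase.cIn, tensorTwist_algebraMap, ← map_mul]
    exact congrArg _ hσ.map_c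
  have hϖ : tensorTwist σ (S.obj (n + 1)) (D'.ϖIn _) * algebraMap R' _ w = D'.ϖIn _ := by
    rw [DeltaBase.ϖIn, tensorTwist_algebraMap, ← map_mul]
    exact congrArg _ hσ.map_ϖ_mul
  have h := tensor_isPiDer hD S n
  induction z with
  | zero => simp [h.map_zero]
  | add x y hx hy =>
    rw [map_add, h.map_add, h.map_add]
    simp only [map_add, map_mul, map_Cp, hx, hy, hc, RingHom.coe_coe, hi]
    ring
  | tmul r a =>
    have hL : tensorδ hD S n (r ⊗ₜ 1) = D'.δ r ⊗ₜ 1 := congrArg W2.snd (tensorW2_left hD S n r)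
    have hL' : tensorδ hD S n (σ r ⊗ₜ 1) = D'.δ (σ r) ⊗ₜ 1 :=
      congrArg W2.snd (tensorW2_left hD S n _)
    have hR : tensorδ hD S n (1 ⊗ₜ a) = D'.c ⊗ₜ S.δ n a :=
      congrArg W2.snd (tensorW2_right hD S n a)
    have e1 : tensorTwist σ (S.obj (n + 1)) (D'.δ r ⊗ₜ 1) =
        algebraMap R' _ w * (D'.δ (σ r) ⊗ₜ 1) := by
      have := hσ.map_δ r
      simp only [RingHom.coe_coe] at this
      simp [this]
    have e2 : tensorTwist σ (S.obj (n + 1)) (D'.c ⊗ₜ S.δ n a) =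
        algebraMap R' _ w * (D'.c ⊗ₜ S.δ n a) := by
      have := hσ.map_c
      simp only [RingHom.coe_coe] at this
      simp [this]
    have e : (r ⊗ₜ[R] a : R' ⊗[R] S.obj n) = (r ⊗ₜ 1) * (1 ⊗ₜ a) := by simp
    rw [e, map_mul, h.map_mul, h.map_mul]
    simp only [map_add, map_mul, map_pow, RingHom.coe_coe, hi, tensorTwist_tmul, map_one, hL, hL',
      hR, e1, e2]
    -- Only the cross term of the product rule differs: σ(ϖ) w² on one side against w ϖ on the
    -- other.
    linear_combination (algebraMap R' _ w * (D'.δ (σ r) ⊗ₜ 1) * (D'.c ⊗ₜ S.δ n a)) * hϖ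

/-- In degree 0 both composites are σ ⊗ 1, both respect the structure maps, and both turn δ into w δ
(by `Jet.semiMap_δ` in the source and `tensorTwist_tensorδ` in the target). Generators of the jet
algebra then decide equality. -/
lemma jetBaseChange_semiMap (hσ : D'.IsTwist σ w) (A : Type u) [CommRing A] [Algebra R A]
    (n : ℕ) (x : Jet D' (R' ⊗[R] A) n) :
    (jetBaseChange hD A).app n
        (Jet.semiMap hσ (tensorTwist σ A) tensorTwist_algebraMap n x) =
      tensorTwist σ (Jet D A n) ((jetBaseChange hD A).app n x) := by
  set T := tensorProlongation hD (jetProlongation D A)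
  have hδ : ∀ n (y : R' ⊗[R] Jet D A n), tensorTwist σ (Jet D A (n + 1)) (T.δ n y) =
      algebraMap R' _ w * T.δ n (tensorTwist σ (Jet D A n) y) :=
    fun n y => tensorTwist_tensorδ hD hσ (jetProlongation D A) n y
  have hi : ∀ n (y : R' ⊗[R] Jet D A n), tensorTwist σ (Jet D A (n + 1)) (T.incl n y) =
      T.incl n (tensorTwist σ (Jet D A n) y) := fun n y => tensorTwist_map (Jet.incl D A n) y
  have := Jet.ringHom_ext (D := D') (A := R' ⊗[R] A) (C := fun n => R' ⊗[R] Jet D A n)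
    (F := fun n => ((jetBaseChange hD A).app n : Jet D' (R' ⊗[R] A) n →+* R' ⊗[R] Jet D A n).comp
      (Jet.semiMap hσ (tensorTwist σ A) tensorTwist_algebraMap n))
    (G := fun n => (tensorTwist σ (Jet D A n)).comp
      ((jetBaseChange hD A).app n : Jet D' (R' ⊗[R] A) n →+* R' ⊗[R] Jet D A n))
    (fun a => ?_) (fun n ih y => ?_) (fun n ih y => ?_) n
  · exact congrArg (fun k => k x) this
  · exact (tensorTwist_map (Jet.zeroEquiv D A).toAlgHom a).symm
  · have ih' := congrArg (fun k => k y) ih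
    have h1 := (jetBaseChange hD A).app_incl n y
    have h2 := (jetBaseChange hD A).app_incl n
      (Jet.semiMap hσ (tensorTwist σ A) tensorTwist_algebraMap n y)
    have h3 := congrArg ((jetBaseChange hD A).app (n + 1))
      (Jet.semiMap_incl hσ (tensorTwist σ A) tensorTwist_algebraMap n y)
    exact h3.trans <| h2.trans ((congrArg (T.incl n) ih').trans
      ((hi n _).symm.trans (congrArg (tensorTwist σ (Jet D A (n + 1))) h1.symm)))
  · have ih' := congrArg (fun k => k y) ih
    have h1 := (jetBaseChange hD A).app_δ n y
    have h2 := (jetBaseChange hD A).app_δ n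
      (Jet.semiMap hσ (tensorTwist σ A) tensorTwist_algebraMap n y)
    have h3 := congrArg ((jetBaseChange hD A).app (n + 1))
      (Jet.semiMap_δ hσ (tensorTwist σ A) tensorTwist_algebraMap n y)
    rw [map_mul, AlgHom.commutes] at h3
    exact h3.trans <| (congrArg _ (h2.trans (congrArg (T.δ n) ih'))).trans
      ((hδ n _).symm.trans (congrArg (tensorTwist σ (Jet D A (n + 1))) h1.symm))

end tensorTwist

/-! ### Completion of ring homomorphisms -/

section completion

variable {p : ℕ} {A B C T : Type u} [CommRing A] [CommRing B] [CommRing C] [CommRing T]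

/-- Every ring homomorphism fixes p, hence is p-adically continuous; the two maps agree modulo every
power of p, and T is separated. No linearity is needed, which makes the statement usable for
semilinear maps. -/
lemma Hat.ringHom_ext [IsAdicComplete (Ideal.span {(p : T)}) T] {f g : Hat p A →+* T}
    (h : ∀ a, f (algebraMap A _ a) = g (algebraMap A _ a)) : f = g := by
  ext x
  rw [← sub_eq_zero]
  refine ((isAdicComplete_iff p T).1 inferInstance).1 _ fun n => ?_
  obtain ⟨a, y, rfl⟩ := Hat.exists_eq (R := A) n x
  have h' : f (Hat.of p A A a) = g (Hat.of p A A a) := h a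
  simp [h', ← mul_sub]

variable (p) in
/-- Functoriality of the `p`-adic completion for ring homomorphisms. -/
def Hat.mapRing (f : A →+* B) : Hat p A →+* Hat p B :=
  -- Taking A itself as the base ring makes any ring homomorphism linear, so `Hat.map` applies.
  letI : Algebra A B := f.toAlgebra
  (Hat.map p (Algebra.ofId A B)).toRingHom

lemma Hat.mapRing_algebraMap (f : A →+* B) (a : A) :
    Hat.mapRing p f (algebraMap A _ a) = algebraMap B _ (f a) :=
  letI : Algebra A B := f.toAlgebra
  Hat.map_of (p := p) (Algebra.ofId A B) a

lemma Hat.mapRing_comp (f : A →+* B) (g : B →+* C) (x : Hat p A) :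
    Hat.mapRing p g (Hat.mapRing p f x) = Hat.mapRing p (g.comp f) x := by
  have : (Hat.mapRing p g).comp (Hat.mapRing p f) = Hat.mapRing p (g.comp f) :=
    Hat.ringHom_ext fun a => by simp only [RingHom.comp_apply, Hat.mapRing_algebraMap]
  exact congrArg (fun k => k x) this

lemma Hat.mapRing_eq_map {R : Type u} [CommRing R] [Algebra R A] [Algebra R B] (f : A →ₐ[R] B)
    (x : Hat p A) : Hat.mapRing p (f : A →+* B) x = Hat.map p f x := by
  have : Hat.mapRing p (f : A →+* B) = (Hat.map p f : Hat p A →+* Hat p B) :=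
    Hat.ringHom_ext fun a => (Hat.mapRing_algebraMap _ a).trans (Hat.map_of f a).symm
  exact congrArg (fun k => k x) this

end completion

/-! ### Equivariance of the completed base change -/

section hatTwist

variable {p : ℕ} [Fact p.Prime] {R : Type u} [CommRing R] {D : DeltaBase p R}
variable {R' : Type u} [CommRing R'] [Algebra R R'] {D' : DeltaBase p R'} (hD : D.IsExt D')
variable {σ : R' →ₐ[R] R'} {w : R'}

/-- The uncompleted identity `jetBaseChange_semiMap` extends by continuity, as R' ⊗ Â is p-adically
complete for R' finite free over R. -/
lemma hatJetBaseChange_semiMap [Module.Free R R'] [Module.Finite R R'] (hσ : D'.IsTwist σ w)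
    (A : Type u) [CommRing A] [Algebra R A] (n : ℕ) (x : Hat p (Jet D' (R' ⊗[R] A) n)) :
    hatJetBaseChange hD A n
        (Hat.mapRing p (Jet.semiMap hσ (tensorTwist σ A) tensorTwist_algebraMap n) x) =
      tensorTwist σ (Hat p (Jet D A n)) (hatJetBaseChange hD A n x) := by
  have h : ∀ a, hatJetBaseChange hD A n (algebraMap _ _ a) =
      Algebra.TensorProduct.map (AlgHom.id R' R') (Hat.of p R (Jet D A n))
        ((jetBaseChange hD A).app n a) := fun a => Hat.lift_of _ a
  have : (hatJetBaseChange hD A n : _ →+* R' ⊗[R] Hat p (Jet D A n)).comp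
      (Hat.mapRing p (Jet.semiMap hσ (tensorTwist σ A) tensorTwist_algebraMap n)) =
      (tensorTwist σ (Hat p (Jet D A n))).comp
        (hatJetBaseChange hD A n : _ →+* R' ⊗[R] Hat p (Jet D A n)) := by
    refine Hat.ringHom_ext fun a => ?_
    simp only [RingHom.comp_apply, RingHom.coe_coe, Hat.mapRing_algebraMap, h]
    exact (congrArg _ (jetBaseChange_semiMap hD hσ A n a)).trans
      (tensorTwist_map (Hat.of p R (Jet D A n)) _).symm
  exact congrArg (fun k => k x) this

end hatTwist

section

open AlgebraicGeometry CategoryTheory CategoryTheory.Limits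

/-! ### Automorphisms of the base change X_{R'} over X -/

section schemeTwist

variable {R : Type u} [CommRing R] {R' : Type u} [CommRing R'] [Algebra R R']
variable {X : Scheme.{u}} (s : X ⟶ Spec (CommRingCat.of R))

lemma ofHom_algebraMap_comp (σ : R' →ₐ[R] R') :
    CommRingCat.ofHom (algebraMap R R') ≫ CommRingCat.ofHom (σ : R' →+* R') =
      CommRingCat.ofHom (algebraMap R R') :=
  CommRingCat.hom_ext (RingHom.ext fun r => σ.commutes r)

/-- The endomorphism of `X_{R'}` over `X` induced by an `R`-algebra endomorphism of `R'`. -/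
def baseChangeTwist (σ : R' →ₐ[R] R') : baseChange s R' ⟶ baseChange s R' :=
  pullback.lift (baseChangeFst s R')
    (baseChangeSnd s R' ≫ Spec.map (CommRingCat.ofHom (σ : R' →+* R'))) (by
      rw [Category.assoc, ← Spec.map_comp, ofHom_algebraMap_comp, pullback.condition])

@[simp] lemma baseChangeTwist_fst (σ : R' →ₐ[R] R') :
    baseChangeTwist s σ ≫ baseChangeFst s R' = baseChangeFst s R' := pullback.lift_fst _ _ _

@[simp] lemma baseChangeTwist_snd (σ : R' →ₐ[R] R') :
    baseChangeTwist s σ ≫ baseChangeSnd s R' =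
      baseChangeSnd s R' ≫ Spec.map (CommRingCat.ofHom (σ : R' →+* R')) := pullback.lift_snd _ _ _

/-- Spec is contravariant: the composite covers Spec of σ ∘ τ, in this order, and lies over the
identity of X. -/
lemma baseChangeTwist_comp (σ τ : R' →ₐ[R] R') (h : σ.comp τ = AlgHom.id R R') :
    baseChangeTwist s σ ≫ baseChangeTwist s τ = 𝟙 _ := by
  have h' : CommRingCat.ofHom (τ : R' →+* R') ≫ CommRingCat.ofHom (σ : R' →+* R') = 𝟙 _ :=
    CommRingCat.hom_ext (RingHom.ext fun r => congrArg (fun k => k r) h)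
  apply pullback.hom_ext
  · simp
  · rw [Category.assoc, baseChangeTwist_snd, ← Category.assoc, baseChangeTwist_snd,
      Category.assoc, ← Spec.map_comp, h', Spec.map_id, Category.comp_id, Category.id_comp]

instance (σ : R' ≃ₐ[R] R') : IsIso (baseChangeTwist s (σ : R' →ₐ[R] R')) :=
  ⟨baseChangeTwist s (σ.symm : R' →ₐ[R] R'),
    baseChangeTwist_comp s _ _ (by ext; simp), baseChangeTwist_comp s _ _ (by ext; simp)⟩

/-- The `σ`-semilinear ring homomorphism `Γ(X_{R'}, V) → Γ(X_{R'}, W)` induced by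
`baseChangeTwist`. -/
def Sec.twist (σ : R' →ₐ[R] R') {V W : (baseChange s R').Opens}
    (h : W ≤ baseChangeTwist s σ ⁻¹ᵁ V) :
    Sec (baseChangeSnd s R') V →+* Sec (baseChangeSnd s R') W :=
  ((baseChangeTwist s σ).appLE V W h).hom

lemma structureMap_twist (σ : R' →ₐ[R] R') {V W : (baseChange s R').Opens}
    (h : W ≤ baseChangeTwist s σ ⁻¹ᵁ V) :
    Sec.structureMap (baseChangeSnd s R') V ≫ (baseChangeTwist s σ).appLE V W h =
      CommRingCat.ofHom (σ : R' →+* R') ≫ Sec.structureMap (baseChangeSnd s R') W := by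
  rw [Sec.structureMap, Sec.structureMap, Category.assoc, Scheme.Hom.appLE_comp_appLE,
    ← Category.assoc, Scheme.ΓSpecIso_inv_naturality, Category.assoc, appTop_eq_appLE,
    Scheme.Hom.appLE_comp_appLE]
  simp only [baseChangeTwist_snd]

lemma Sec.twist_algebraMap (σ : R' →ₐ[R] R') {V W : (baseChange s R').Opens}
    (h : W ≤ baseChangeTwist s σ ⁻¹ᵁ V) (r : R') :
    Sec.twist s σ h (algebraMap R' _ r) = algebraMap R' _ ((σ : R' →+* R') r) :=
  congrArg (fun k => k.hom r) (structureMap_twist s σ h)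

lemma Sec.res_twist (σ : R' →ₐ[R] R') {V W W' : (baseChange s R').Opens}
    (h : W ≤ baseChangeTwist s σ ⁻¹ᵁ V) (i : W' ≤ W) (x : Sec (baseChangeSnd s R') V) :
    Sec.res (baseChangeSnd s R') i (Sec.twist s σ h x) = Sec.twist s σ (i.trans h) x :=
  congrArg (fun k => k.hom x) (Scheme.Hom.appLE_map (baseChangeTwist s σ) h (homOfLE i).op)

lemma Sec.twist_res (σ : R' →ₐ[R] R') {V V' W : (baseChange s R').Opens}
    (h : W ≤ baseChangeTwist s σ ⁻¹ᵁ V) (h' : W ≤ baseChangeTwist s σ ⁻¹ᵁ V') (i : V ≤ V')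
    (x : Sec (baseChangeSnd s R') V') :
    Sec.twist s σ h (Sec.res (baseChangeSnd s R') i x) = Sec.twist s σ h' x :=
  congrArg (fun k => k.hom x) (Scheme.Hom.map_appLE (baseChangeTwist s σ) h (homOfLE i).op)

/-- The twist is a morphism over X, so it preserves the inverse image of every open of X. -/
lemma affinePreimage_le (σ : R' →ₐ[R] R') (U : X.affineOpens) :
    (affinePreimage s R' U).1 ≤ baseChangeTwist s σ ⁻¹ᵁ (affinePreimage s R' U).1 := by
  change _ ≤ baseChangeTwist s σ ⁻¹ᵁ (baseChangeFst s R' ⁻¹ᵁ U.1)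
  rw [← Scheme.Hom.comp_preimage, baseChangeTwist_fst]
  exact le_rfl

/-- A morphism to the fibre product is determined by its two projections. On X nothing changes
because σ ⊗ 1 fixes 1 ⊗ x, and on Spec R' both sides come from r ↦ σ(r) ⊗ 1. Thus on U_{R'} the
geometric twist is σ ⊗ 1. -/
lemma specToBaseChange_twist (σ : R' →ₐ[R] R') {U : X.Opens} (hU : IsAffineOpen U) :
    specToBaseChange s R' hU ≫ baseChangeTwist s σ =
      Spec.map (CommRingCat.ofHom (tensorTwist σ (Sec s U))) ≫ specToBaseChange s R' hU := by
  apply pullback.hom_ext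
  · rw [Category.assoc, baseChangeTwist_fst, Category.assoc, specToBaseChange, pullback.lift_fst,
      ← Category.assoc, ← Spec.map_comp]
    congr 2
    refine CommRingCat.hom_ext (RingHom.ext fun x => ?_)
    exact ((tensorTwist_tmul (σ := σ) (A := Sec s U) 1 x).trans (by rw [map_one]; rfl)).symm
  · rw [Category.assoc, baseChangeTwist_snd, Category.assoc, specToBaseChange,
      pullback.lift_snd, pullback.lift_snd_assoc, ← Spec.map_comp, ← Spec.map_comp]
    congr 1

lemma secBaseChangeHom_twist (σ : R' →ₐ[R] R') {U : X.Opens} (hU : IsAffineOpen U)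
    (h : baseChangeFst s R' ⁻¹ᵁ U ≤ baseChangeTwist s σ ⁻¹ᵁ (baseChangeFst s R' ⁻¹ᵁ U)) :
    (baseChangeTwist s σ).appLE _ _ h ≫ secBaseChangeHom s R' hU =
      secBaseChangeHom s R' hU ≫ CommRingCat.ofHom (tensorTwist σ (Sec s U)) := by
  rw [secBaseChangeHom, Category.assoc, ← Scheme.ΓSpecIso_naturality, appTop_eq_appLE,
    Scheme.Hom.appLE_comp_appLE_assoc, Scheme.Hom.appLE_comp_appLE_assoc]
  have := specToBaseChange_twist s σ hU
  simp only [this]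

lemma secBaseChange_twist (σ : R' →ₐ[R] R') (U : X.affineOpens)
    (x : Sec (baseChangeSnd s R') (affinePreimage s R' U).1) :
    secBaseChange s R' U (Sec.twist s σ (affinePreimage_le s σ U) x) =
      tensorTwist σ (Sec s U.1) (secBaseChange s R' U x) := by
  exact congrArg (fun k => k.hom x) (secBaseChangeHom_twist s σ U.2 (affinePreimage_le s σ U))

end schemeTwist

/-! ### The action on global functions of jet spaces, and the trace -/

section global

variable {p : ℕ} [Fact p.Prime] {R : Type u} [CommRing R] {D : DeltaBase p R}
variable {R' : Type u} [CommRing R'] [Algebra R R'] {D' : DeltaBase p R'} (hD : D.IsExt D')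
variable {X : Scheme.{u}} (s : X ⟶ Spec (CommRingCat.of R)) (n : ℕ)
variable {σ : R' ≃ₐ[R] R'} {w : R'} (hσ : D'.IsTwist ((σ : R' →ₐ[R] R') : R' →+* R') w)

/-- The map induced by `Sec.twist` on the completed jets. -/
def hatTwist {V W : (baseChange s R').Opens}
    (h : W ≤ baseChangeTwist s (σ : R' →ₐ[R] R') ⁻¹ᵁ V) :
    Hat p (Jet D' (Sec (baseChangeSnd s R') V) n) →+*
      Hat p (Jet D' (Sec (baseChangeSnd s R') W) n) :=
  Hat.mapRing p (Jet.semiMap hσ (Sec.twist s _ h) (Sec.twist_algebraMap s _ h) n)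

lemma res_hatTwist {V W W' : (baseChange s R').Opens}
    (h : W ≤ baseChangeTwist s (σ : R' →ₐ[R] R') ⁻¹ᵁ V) (i : W' ≤ W)
    (x : Hat p (Jet D' (Sec (baseChangeSnd s R') V) n)) :
    Hat.map p (Jet.map D' (Sec.res (baseChangeSnd s R') i) n) (hatTwist s n hσ h x) =
      hatTwist s n hσ (i.trans h) x := by
  rw [hatTwist, hatTwist, ← Hat.mapRing_eq_map, Hat.mapRing_comp]
  congr 2
  exact Jet.map_comp_semiMap hσ _ _ _ _ _ (Sec.res_twist s _ h i) n

lemma hatTwist_res {V V' W : (baseChange s R').Opens}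
    (h : W ≤ baseChangeTwist s (σ : R' →ₐ[R] R') ⁻¹ᵁ V)
    (h' : W ≤ baseChangeTwist s (σ : R' →ₐ[R] R') ⁻¹ᵁ V') (i : V ≤ V')
    (x : Hat p (Jet D' (Sec (baseChangeSnd s R') V') n)) :
    hatTwist s n hσ h (Hat.map p (Jet.map D' (Sec.res (baseChangeSnd s R') i) n) x) =
      hatTwist s n hσ h' x := by
  rw [hatTwist, hatTwist, ← Hat.mapRing_eq_map, Hat.mapRing_comp]
  congr 2
  exact Jet.semiMap_comp_map hσ _ _ _ _ _ (Sec.twist_res s _ h h' i) n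

variable (σ) in
/-- The translate of an affine open `W` of `X_{R'}` whose preimage under `baseChangeTwist` is
`W`. -/
def affineTranslate (W : (baseChange s R').affineOpens) : (baseChange s R').affineOpens :=
  ⟨baseChangeTwist s (σ.symm : R' →ₐ[R] R') ⁻¹ᵁ W.1, W.2.preimage _⟩

variable (σ) in
lemma le_affineTranslate (W : (baseChange s R').affineOpens) :
    W.1 ≤ baseChangeTwist s (σ : R' →ₐ[R] R') ⁻¹ᵁ (affineTranslate s σ W).1 := by
  rw [affineTranslate, ← Scheme.Hom.comp_preimage, baseChangeTwist_comp s _ _ (by ext; simp),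
    Scheme.Hom.id_preimage]

/-- The action of `σ` on the functions on the `n`-th jet space of `X_{R'}`. -/
def JetFun.twist (g : JetFun (baseChangeSnd s R') D' n) : JetFun (baseChangeSnd s R') D' n :=
  -- A general affine open W of X_{R'} is not stable under the twist, so the value at W is
  -- transported from the translate of W.
  ⟨fun W => hatTwist s n hσ (le_affineTranslate s σ W) (g.1 (affineTranslate s σ W)),
    fun U V h => by
      have hUV : (affineTranslate s σ U).1 ≤ (affineTranslate s σ V).1 := fun _ hx => h hx
      -- Both sides equal the twist taken directly from the translate of V to U, after which
      -- compatibility of g on the translates applies.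
      exact (res_hatTwist s n hσ _ h _).trans ((hatTwist_res s n hσ (le_affineTranslate s σ U) _
        hUV _).symm.trans (congrArg _ (g.2 _ _ hUV)))⟩

variable [Module.Free R R'] [Module.Finite R R']

/-- The identification of functions on U_{R'} with R' ⊗ Γ(X, U) carries the twist to σ ⊗ 1
(`secBaseChange_twist`), and the completed base change of jets is equivariant for σ ⊗ 1
(`hatJetBaseChange_semiMap`). -/
lemma localInclusion_hatTwist (U : X.affineOpens)
    (x : Hat p (Jet D' (Sec (baseChangeSnd s R') (affinePreimage s R' U).1) n)) :
    localInclusion hD s n U (hatTwist s n hσ (affinePreimage_le s _ U) x) =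
      tensorTwist (σ : R' →ₐ[R] R') _ (localInclusion hD s n U x) := by
  rw [localInclusion, AlgHom.comp_apply, AlgHom.comp_apply, ← hatJetBaseChange_semiMap hD hσ,
    hatTwist, ← Hat.mapRing_eq_map, ← Hat.mapRing_eq_map, Hat.mapRing_comp, Hat.mapRing_comp]
  congr 3
  have hg : ∀ r, ((tensorTwist (σ : R' →ₐ[R] R') (Sec s U.1)).comp
      (secBaseChange s R' U : Sec (baseChangeSnd s R') (affinePreimage s R' U).1 →+*
        R' ⊗[R] Sec s U.1)) (algebraMap R' _ r) =
      algebraMap R' _ (((σ : R' →ₐ[R] R') : R' →+* R') r) := fun r => by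
    rw [RingHom.comp_apply, RingHom.coe_coe, AlgHom.commutes]
    exact tensorTwist_algebraMap r
  -- Both composites are the semilinear jet map of `tensorTwist` after `secBaseChange`.
  exact (Jet.map_comp_semiMap hσ _ _ _ _ hg (secBaseChange_twist s _ U) n).trans
    (Jet.semiMap_comp_map hσ _ _ _ _ hg (fun _ => rfl) n).symm

/-- This is the equivariance ι(σ·g) = (σ ⊗ 1) ι(g). Elements of R' ⊗ 𝒪(J^n_p(X)) are detected on the
affine opens U of X, and over these U_{R'} is stable under σ, so the local statement suffices. -/
lemma jetInclusion_twist (g : JetFun (baseChangeSnd s R') D' n) :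
    jetInclusion hD s n (JetFun.twist s n hσ g) =
      tensorTwist (σ : R' →ₐ[R] R') _ (jetInclusion hD s n g) := by
  apply tensorRestrict_injective s n
  funext U
  have hU : (affinePreimage s R' U).1 ≤ (affineTranslate s σ (affinePreimage s R' U)).1 :=
    affinePreimage_le s _ U
  -- The translate of U_{R'} is U_{R'} again. With this inclusion the value of g at the translate is
  -- a restriction of its value at U_{R'}, and no rewriting along an equality of opens is required.
  have hU' : (affineTranslate s σ (affinePreimage s R' U)).1 ≤ (affinePreimage s R' U).1 := by
    change baseChangeTwist s (σ.symm : R' →ₐ[R] R') ⁻¹ᵁ (baseChangeFst s R' ⁻¹ᵁ U.1) ≤ _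
    rw [← Scheme.Hom.comp_preimage, baseChangeTwist_fst]
    exact le_rfl
  have h : (JetFun.twist s n hσ g).1 (affinePreimage s R' U) =
      hatTwist s n hσ (affinePreimage_le s _ U) (g.1 (affinePreimage s R' U)) := by
    rw [← hatTwist_res s n hσ (le_affineTranslate s σ _) (affinePreimage_le s _ U) hU',
      g.2 _ _ hU']
    rfl
  refine (jetInclusion_restrict hD s n _ U).trans ?_
  rw [h, localInclusion_hatTwist, ← jetInclusion_restrict]
  exact tensorTwist_map (JetFun.restrict s D n U) _

/-- If the sum of the automorphisms `σ i` of `R'` is the trace, then `1 ⊗ Tr(z)` is the sum of the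
conjugates of `z`. -/
lemma sum_tensorTwist {ι : Type*} [Fintype ι] (σ : ι → R' ≃ₐ[R] R')
    (hσ : ∀ r, ∑ i, σ i r = algebraMap R R' (Algebra.trace R R' r)) {A : Type u} [CommRing A]
    [Algebra R A] (z : R' ⊗[R] A) :
    ∑ i, tensorTwist (σ i : R' →ₐ[R] R') A z = 1 ⊗ₜ tensorTrace R' A z := by
  induction z with
  | zero => simp
  | add x y hx hy => simp only [map_add, Finset.sum_add_distrib, hx, hy, TensorProduct.tmul_add]
  | tmul r a =>
    have h : ∀ i, (σ i : R' →ₐ[R] R') r = σ i r := fun _ => rfl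
    simp only [tensorTwist_tmul, h, ← TensorProduct.sum_tmul, hσ, tensorTrace,
      LinearMap.comp_apply, LinearMap.rTensor_tmul, LinearEquiv.coe_coe, TensorProduct.lid_tmul,
      TensorProduct.tmul_smul, TensorProduct.smul_tmul', Algebra.algebraMap_eq_smul_one]

/-- The image of the arithmetic trace is contained in the image of `jetInclusion` when the trace of
`R'` over `R` is a sum of automorphisms compatible with `δ`. -/
lemma exists_jetInclusion_eq_arithTrace {ι : Type*} [Fintype ι] (σ : ι → R' ≃ₐ[R] R')
    (hσ : ∀ r, ∑ i, σ i r = algebraMap R R' (Algebra.trace R R' r))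
    (hw : ∀ i, ∃ w, D'.IsTwist ((σ i : R' →ₐ[R] R') : R' →+* R') w)
    (g : JetFun (baseChangeSnd s R') D' n) :
    ∃ g', jetInclusion hD s n g' = 1 ⊗ₜ[R] arithTrace hD s n g := by
  choose w hw using hw
  -- The witness is the sum of the conjugates of g: by equivariance its image is the sum of the
  -- conjugates of ι(g), which is 1 ⊗ Tr.
  refine ⟨∑ i, JetFun.twist s n (hw i) g, ?_⟩
  rw [map_sum]
  simp only [jetInclusion_twist]
  exact sum_tensorTwist σ hσ _

/-- If `1 ⊗ h` is in the image of `jetInclusion`, then the multiples of `h` by the degree of `R'`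
over `R` are in the image of the arithmetic trace. -/
lemma arithTrace_smul_of_jetInclusion_eq (r : R) (g : JetFun (baseChangeSnd s R') D' n)
    (h : JetFun s D n) (hg : jetInclusion hD s n g = 1 ⊗ₜ h) :
    arithTrace hD s n (algebraMap R R' r • g) = (r * Algebra.trace R R' 1) • h := by
  have : arithTrace hD s n (algebraMap R R' r • g) =
      tensorTrace R' _ (jetInclusion hD s n (algebraMap R R' r • g)) := rfl
  rw [this, map_smul, hg, algebraMap_smul, map_smul, mul_smul]
  simp [tensorTrace]

end global

end

/-! ### The trace of A[X]/(f) and change of coefficients -/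

open Polynomial

/-- The summands are the diagonal entries of multiplication by q in the power basis 1, X, X², ….
Division by a monic polynomial commutes with mapping coefficients, so this formula makes
compatibility with base change visible. -/
lemma trace_adjoinRoot_mk {A : Type*} [CommRing A] [Nontrivial A] {f : A[X]} (hf : f.Monic)
    (q : A[X]) : Algebra.trace A (AdjoinRoot f) (AdjoinRoot.mk f q) =
      ∑ i ∈ Finset.range f.natDegree, ((q * X ^ i) %ₘ f).coeff i := by
  rw [Algebra.trace_eq_matrix_trace (AdjoinRoot.powerBasis' hf).basis, Matrix.trace,
    Finset.sum_range]
  refine Finset.sum_congr rfl fun i _ => ?_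
  rw [Matrix.diag_apply, Algebra.leftMulMatrix_eq_repr_mul, PowerBasis.basis_eq_pow]
  have : AdjoinRoot.mk f q * (AdjoinRoot.powerBasis' hf).gen ^ (i : ℕ) =
      AdjoinRoot.mk f (q * X ^ (i : ℕ)) := by
    rw [map_mul, map_pow, AdjoinRoot.mk_X]; rfl
  rw [this]
  rfl

/-- The trace of `A[X]/(f)`, for `f` monic, commutes with base change. -/
lemma trace_adjoinRoot_map {A B : Type*} [CommRing A] [CommRing B] [Nontrivial A] [Nontrivial B]
    (φ : A →+* B) {f : A[X]} (hf : f.Monic) (x : AdjoinRoot f) :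
    Algebra.trace B (AdjoinRoot (f.map φ)) (AdjoinRoot.map φ f (f.map φ) dvd_rfl x) =
      φ (Algebra.trace A (AdjoinRoot f) x) := by
  obtain ⟨q, rfl⟩ := AdjoinRoot.mk_surjective x
  have h : AdjoinRoot.map φ f (f.map φ) dvd_rfl (AdjoinRoot.mk f q) =
      AdjoinRoot.mk (f.map φ) (q.map φ) := by
    rw [AdjoinRoot.map, AdjoinRoot.lift_mk, ← Polynomial.eval₂_map, ← AdjoinRoot.aeval_eq]
    rfl
  rw [h, trace_adjoinRoot_mk (hf.map φ), trace_adjoinRoot_mk hf, map_sum, hf.natDegree_map]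
  refine Finset.sum_congr rfl fun i _ => ?_
  rw [← Polynomial.coeff_map, Polynomial.map_modByMonic _ hf]
  simp

/-! ### ℤ_p[π] as the ring of integers of ℚ_p(π) -/

variable {p : ℕ} [Fact p.Prime] (E : EisensteinPoly p)

/-- The ring `ℤ_p[π]`. -/
abbrev ZpPi : Type := AdjoinRoot E.poly

/-- The embedding `ℤ_p[π] → R_π`. -/
def zpPiToRpi : ZpPi E →+* Rpi E := AdjoinRoot.map (zpToRp p) E.poly _ dvd_rfl

instance : Algebra (ZpPi E) (QpPi E) :=
  (AdjoinRoot.map (algebraMap ℤ_[p] ℚ_[p]) E.poly _ dvd_rfl).toAlgebra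

lemma algebraMap_zpPi_mk (q : ℤ_[p][X]) :
    algebraMap (ZpPi E) (QpPi E) (AdjoinRoot.mk E.poly q) =
      AdjoinRoot.mk _ (q.map (algebraMap ℤ_[p] ℚ_[p])) := by
  change AdjoinRoot.map (algebraMap ℤ_[p] ℚ_[p]) E.poly _ dvd_rfl _ = _
  rw [AdjoinRoot.map, AdjoinRoot.lift_mk, ← Polynomial.eval₂_map, ← AdjoinRoot.aeval_eq]
  rfl

instance : IsScalarTower ℤ_[p] (ZpPi E) (QpPi E) := IsScalarTower.of_algebraMap_eq fun x => by
  have h := algebraMap_zpPi_mk E (C x)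
  rw [Polynomial.map_C] at h
  exact h.symm

/-- As ℤ_p is integrally closed, the minimal polynomial over ℤ_p becomes the one over ℚ_p, and E is
monic and irreducible there. The Eisenstein criterion for integral elements is stated in terms of
this minimal polynomial. -/
lemma minpoly_root_QpPi :
    minpoly ℤ_[p] (AdjoinRoot.root (E.poly.map (algebraMap ℤ_[p] ℚ_[p]))) = E.poly := by
  have hint : IsIntegral ℤ_[p] (AdjoinRoot.root (E.poly.map (algebraMap ℤ_[p] ℚ_[p]))) :=
    ⟨E.poly, E.monic, by
      rw [← Polynomial.aeval_def, ← Polynomial.aeval_map_algebraMap ℚ_[p]]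
      exact AdjoinRoot.eval₂_root _⟩
  apply Polynomial.map_injective _ (IsFractionRing.injective ℤ_[p] ℚ_[p])
  rw [← minpoly.isIntegrallyClosed_eq_field_fractions' ℚ_[p] hint,
    AdjoinRoot.minpoly_root (E.monic.map _).ne_zero, (E.monic.map _).leadingCoeff]
  simp

/-- Denominators of a polynomial representing z are cleared by some nonzero b ∈ ℤ_p, and b is a unit
times a power of p; the exponent is the valuation of b. -/
lemma exists_pow_smul_mem (z : QpPi E) : ∃ n : ℕ, (p : ℤ_[p]) ^ n • z ∈
    Algebra.adjoin ℤ_[p] {AdjoinRoot.root (E.poly.map (algebraMap ℤ_[p] ℚ_[p]))} := by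
  obtain ⟨q, rfl⟩ := AdjoinRoot.mk_surjective z
  obtain ⟨b, hbM, hb⟩ := IsLocalization.integerNormalization_spec (nonZeroDivisors ℤ_[p]) q
  have hb0 : b ≠ 0 := nonZeroDivisors.ne_zero hbM
  refine ⟨b.valuation, ?_⟩
  have hu := PadicInt.unitCoeff_spec hb0
  have hpn : (p : ℤ_[p]) ^ b.valuation =
      ((PadicInt.unitCoeff hb0)⁻¹ : ℤ_[p]ˣ) * b := by
    rw [Units.eq_inv_mul_iff_mul_eq]
    exact hu.symm
  rw [hpn, mul_smul]
  refine Subalgebra.smul_mem _ ?_ _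
  have h : b • AdjoinRoot.mk (E.poly.map (algebraMap ℤ_[p] ℚ_[p])) q =
      aeval (AdjoinRoot.root (E.poly.map (algebraMap ℤ_[p] ℚ_[p])))
        (IsLocalization.integerNormalization (nonZeroDivisors ℤ_[p]) q) := by
    rw [← Polynomial.aeval_map_algebraMap ℚ_[p], hb, AdjoinRoot.aeval_eq]
    exact AdjoinRoot.smul_mk _ b q
  rw [h]
  exact Polynomial.aeval_mem_adjoin_singleton _ _

instance : Module.Finite ℤ_[p] (ZpPi E) := E.monic.finite_adjoinRoot
instance : Module.Finite ℚ_[p] (QpPi E) := (E.monic.map _).finite_adjoinRoot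

/-- `ℤ_p[π]` is the ring of integers of `ℚ_p(π)`. -/
instance : IsIntegralClosure (ZpPi E) ℤ_[p] (QpPi E) where
  algebraMap_injective := by
    rw [injective_iff_map_eq_zero]
    intro x hx
    obtain ⟨q, rfl⟩ := AdjoinRoot.mk_surjective x
    rw [algebraMap_zpPi_mk, AdjoinRoot.mk_eq_zero,
      Polynomial.map_dvd_map _ (IsFractionRing.injective ℤ_[p] ℚ_[p]) E.monic] at hx
    exact AdjoinRoot.mk_eq_zero.2 hx
  isIntegral_iff {z} := by
    refine ⟨fun hz => ?_, ?_⟩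
    · have hmin := minpoly_root_QpPi E
      have hint : IsIntegral ℤ_[p] (AdjoinRoot.root (E.poly.map (algebraMap ℤ_[p] ℚ_[p]))) := by
        -- The minimal polynomial of a non-integral element is 0 by convention, whereas here it is
        -- monic.
        by_contra h
        exact E.monic.ne_zero (hmin.symm.trans (minpoly.eq_zero h))
      obtain ⟨n, hn⟩ := exists_pow_smul_mem E z
      -- For π Eisenstein at p, an integral element with a p-power multiple in ℤ_p[π] already lies
      -- in ℤ_p[π].
      have h := mem_adjoin_of_smul_prime_pow_smul_of_minpoly_isEisensteinAt
        (B := AdjoinRoot.powerBasis (E.monic.map (algebraMap ℤ_[p] ℚ_[p])).ne_zero)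
        PadicInt.prime_p hint hz hn (by
          change (minpoly ℤ_[p] (AdjoinRoot.root _)).IsEisensteinAt _
          rw [hmin]; exact E.eisenstein)
      obtain ⟨q, hq⟩ := Algebra.adjoin_singleton_eq_range_aeval ℤ_[p]
        (AdjoinRoot.root (E.poly.map (algebraMap ℤ_[p] ℚ_[p]))) ▸ h
      refine ⟨AdjoinRoot.mk _ q, ?_⟩
      rw [algebraMap_zpPi_mk, ← AdjoinRoot.aeval_eq, Polynomial.aeval_map_algebraMap]
      exact hq
    · rintro ⟨y, rfl⟩
      exact (Algebra.IsIntegral.isIntegral (R := ℤ_[p]) y).map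
        (IsScalarTower.toAlgHom ℤ_[p] (ZpPi E) (QpPi E))

/-! ### Extending automorphisms of ℤ_p[π] to R_π -/

lemma zpPiToRpi_root : zpPiToRpi E (AdjoinRoot.root E.poly) = piElt E :=
  AdjoinRoot.map_root ..

lemma zpPiToRpi_algebraMap (x : ℤ_[p]) :
    zpPiToRpi E (algebraMap ℤ_[p] _ x) = algebraMap (Rp p) (Rpi E) (zpToRp p x) :=
  AdjoinRoot.map_of ..

lemma phiRpi_zpPiToRpi (x : ZpPi E) : phiRpi E (zpPiToRpi E x) = zpPiToRpi E x := by
  have : (phiRpi E).comp (zpPiToRpi E) = zpPiToRpi E := by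
    apply AdjoinRoot.ringHom_ext
    · ext x
      change phiRpi E (zpPiToRpi E (algebraMap ℤ_[p] _ x)) = zpPiToRpi E (algebraMap ℤ_[p] _ x)
      rw [zpPiToRpi_algebraMap, phiRpi_of, frobenius_zpToRp]
    · rw [RingHom.comp_apply, zpPiToRpi_root, phiRpi_pi]
  exact congrArg (fun k => k x) this

lemma eval_zpPiToRpi (τ : ZpPi E →ₐ[ℤ_[p]] ZpPi E) :
    (E.poly.map (zpToRp p)).eval₂ (algebraMap (Rp p) (Rpi E))
      (zpPiToRpi E (τ (AdjoinRoot.root E.poly))) = 0 := by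
  have h1 : aeval (τ (AdjoinRoot.root E.poly)) E.poly = 0 := by
    rw [Polynomial.aeval_algHom_apply, AdjoinRoot.aeval_eq, AdjoinRoot.mk_self, map_zero]
  have h2 : (algebraMap (Rp p) (Rpi E)).comp (zpToRp p) =
      (zpPiToRpi E).comp (algebraMap ℤ_[p] (ZpPi E)) :=
    RingHom.ext fun x => (zpPiToRpi_algebraMap E x).symm
  rw [Polynomial.eval₂_map, h2, ← Polynomial.hom_eval₂, ← Polynomial.aeval_def, h1, map_zero]

/-- The extension of an endomorphism of `ℤ_p[π]` to an `R_p`-linear endomorphism of `R_π`. -/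
def extendRpi (τ : ZpPi E →ₐ[ℤ_[p]] ZpPi E) : Rpi E →ₐ[Rp p] Rpi E :=
  AdjoinRoot.liftAlgHom _ (Algebra.ofId (Rp p) (Rpi E))
    (zpPiToRpi E (τ (AdjoinRoot.root E.poly))) (eval_zpPiToRpi E τ)

lemma extendRpi_pi (τ : ZpPi E →ₐ[ℤ_[p]] ZpPi E) :
    extendRpi E τ (piElt E) = zpPiToRpi E (τ (AdjoinRoot.root E.poly)) :=
  AdjoinRoot.liftAlgHom_root ..

lemma extendRpi_zpPiToRpi (τ : ZpPi E →ₐ[ℤ_[p]] ZpPi E) (x : ZpPi E) :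
    extendRpi E τ (zpPiToRpi E x) = zpPiToRpi E (τ x) := by
  have : (extendRpi E τ : Rpi E →+* Rpi E).comp (zpPiToRpi E) =
      (zpPiToRpi E).comp (τ : ZpPi E →+* ZpPi E) := by
    apply AdjoinRoot.ringHom_ext
    · ext x
      change extendRpi E τ (zpPiToRpi E (algebraMap ℤ_[p] _ x)) =
        zpPiToRpi E (τ (algebraMap ℤ_[p] _ x))
      rw [AlgHom.commutes, zpPiToRpi_algebraMap, AlgHom.commutes]
    · simp [zpPiToRpi_root, extendRpi_pi]
  exact congrArg (fun k => k x) this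

lemma rpi_algHom_ext {A : Type*} [CommRing A] [Algebra (Rp p) A] {f g : Rpi E →ₐ[Rp p] A}
    (h : f (piElt E) = g (piElt E)) : f = g := AdjoinRoot.algHom_ext h

lemma extendRpi_comp (τ τ' : ZpPi E →ₐ[ℤ_[p]] ZpPi E) :
    (extendRpi E τ).comp (extendRpi E τ') = extendRpi E (τ.comp τ') := by
  apply rpi_algHom_ext
  rw [AlgHom.comp_apply, extendRpi_pi, extendRpi_zpPiToRpi, extendRpi_pi, AlgHom.comp_apply]

lemma extendRpi_id : extendRpi E (AlgHom.id _ _) = AlgHom.id _ _ := by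
  apply rpi_algHom_ext
  rw [extendRpi_pi, AlgHom.id_apply, AlgHom.id_apply, zpPiToRpi_root]

/-- The automorphism of `R_π` over `R_p` attached to an automorphism of `ℤ_p[π]` over `ℤ_p`. -/
def extendRpiEquiv (τ : ZpPi E ≃ₐ[ℤ_[p]] ZpPi E) : Rpi E ≃ₐ[Rp p] Rpi E :=
  AlgEquiv.ofAlgHom (extendRpi E τ) (extendRpi E τ.symm)
    (by rw [extendRpi_comp, ← extendRpi_id]; congr 1; ext; simp)
    (by rw [extendRpi_comp, ← extendRpi_id]; congr 1; ext; simp)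

/-- On R_p both sides are the Frobenius. On π both are the conjugate of π, which belongs to ℤ_p[π]
and is therefore fixed by φ; this is where it matters that the conjugates lie in ℤ_p[π]. -/
lemma extendRpi_phi (τ : ZpPi E →ₐ[ℤ_[p]] ZpPi E) (x : Rpi E) :
    extendRpi E τ (phiRpi E x) = phiRpi E (extendRpi E τ x) := by
  have : (extendRpi E τ : Rpi E →+* Rpi E).comp (phiRpi E) =
      (phiRpi E).comp (extendRpi E τ : Rpi E →+* Rpi E) := by
    apply AdjoinRoot.ringHom_ext
    · ext1 x
      change extendRpi E τ (phiRpi E (algebraMap (Rp p) _ x)) =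
        phiRpi E (extendRpi E τ (algebraMap (Rp p) _ x))
      rw [phiRpi_of, AlgHom.commutes, AlgHom.commutes, phiRpi_of]
    · change extendRpi E τ (phiRpi E (piElt E)) = phiRpi E (extendRpi E τ (piElt E))
      rw [phiRpi_pi, extendRpi_pi, phiRpi_zpPiToRpi]
  exact congrArg (fun k => k x) this

/-! ### Reduction modulo π and the factor w = π/σ(π) -/

lemma coeff_constantCoeff_eq_zero {i : ℕ} (hi : i ≠ E.poly.natDegree) :
    WittVector.constantCoeff (zpToRp p (E.poly.coeff i)) = 0 := by
  have hmem : E.poly.coeff i ∈ Ideal.span {(p : ℤ_[p])} := by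
    rcases lt_or_gt_of_ne hi with h | h
    · exact E.eisenstein.mem h
    · rw [Polynomial.coeff_eq_zero_of_natDegree_lt h]; exact zero_mem _
  obtain ⟨u, hu⟩ := Ideal.mem_span_singleton.1 hmem
  rw [hu, map_mul, map_mul, map_natCast, map_natCast, CharP.cast_eq_zero, zero_mul]

/-- All coefficients except the leading one are divisible by p. Consequently 0 is the only root over
the residue field, which gives the reduction map π ↦ 0 and forces every conjugate of π to reduce to
0. -/
lemma map_constantCoeff_poly : (E.poly.map (zpToRp p)).map WittVector.constantCoeff =
    (X ^ E.poly.natDegree : (AlgebraicClosure (ZMod p))[X]) := by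
  ext i
  rw [Polynomial.coeff_map, Polynomial.coeff_map, Polynomial.coeff_X_pow]
  split_ifs with h
  · rw [h, Polynomial.coeff_natDegree, E.monic.leadingCoeff, map_one, map_one]
  · exact coeff_constantCoeff_eq_zero E h

/-- The reduction of `R_π` modulo `π`. -/
def residueRpi : Rpi E →+* AlgebraicClosure (ZMod p) :=
  AdjoinRoot.lift WittVector.constantCoeff 0 (by
    rw [← Polynomial.eval_map, map_constantCoeff_poly, Polynomial.eval_pow, Polynomial.eval_X,
      zero_pow (by have := E.two_le_natDegree; omega)])

lemma residueRpi_pi : residueRpi E (piElt E) = 0 := AdjoinRoot.lift_root _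

lemma residueRpi_algebraMap (r : Rp p) :
    residueRpi E (algebraMap (Rp p) _ r) = WittVector.constantCoeff r := AdjoinRoot.lift_of _

/-- Every element is π y + r with r ∈ R_p; vanishing of its reduction means p ∣ r, and π ∣ p. -/
lemma pi_dvd_of_residueRpi_eq_zero {x : Rpi E} (hx : residueRpi E x = 0) : piElt E ∣ x := by
  obtain ⟨y, r, rfl⟩ := exists_eq_pi_mul_add E x
  rw [map_add, map_mul, residueRpi_pi, zero_mul, zero_add, residueRpi_algebraMap,
    ← RingHom.mem_ker, WittVector.ker_constantCoeff, Ideal.mem_span_singleton] at hx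
  obtain ⟨z, rfl⟩ := hx
  rw [map_mul, map_natCast]
  exact dvd_add (Dvd.intro _ rfl) ((pi_dvd_p E).mul_right _)

/-- The conjugate is a root of E, so the e-th power of its reduction is 0 in a field. -/
lemma pi_dvd_extendRpi_pi (τ : ZpPi E →ₐ[ℤ_[p]] ZpPi E) :
    piElt E ∣ extendRpi E τ (piElt E) := by
  apply pi_dvd_of_residueRpi_eq_zero
  have h := congrArg (residueRpi E) (eval_zpPiToRpi E τ)
  have h' : (residueRpi E).comp (algebraMap (Rp p) (Rpi E)) = WittVector.constantCoeff :=
    RingHom.ext (residueRpi_algebraMap E)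
  rw [Polynomial.hom_eval₂, h', ← Polynomial.eval_map, map_constantCoeff_poly,
    Polynomial.eval_pow, Polynomial.eval_X, map_zero] at h
  rw [extendRpi_pi]
  exact eq_zero_of_pow_eq_zero h

/-- Since σ commutes with φ, applying σ to p = π c and to π δ(r) = φ(r) - r^p gives the required
identities after cancelling σ(π). -/
lemma exists_isTwist (τ : ZpPi E ≃ₐ[ℤ_[p]] ZpPi E) :
    ∃ w, (piBase E).IsTwist ((extendRpiEquiv E τ : Rpi E →ₐ[Rp p] Rpi E) : Rpi E →+* Rpi E) w := by
  set σ := ((extendRpiEquiv E τ : Rpi E →ₐ[Rp p] Rpi E) : Rpi E →+* Rpi E)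
  have hσ : ∀ x, σ x = extendRpi E τ x := fun _ => rfl
  -- Divisibility is used for the inverse automorphism: σ⁻¹(π) = π v gives π = σ(π) σ(v), so w =
  -- σ(v).
  obtain ⟨v, hv⟩ := pi_dvd_extendRpi_pi E (τ.symm : ZpPi E →ₐ[ℤ_[p]] ZpPi E)
  have hw : σ (piElt E) * σ v = piElt E := by
    rw [← map_mul, ← hv]
    exact (extendRpiEquiv E τ).apply_symm_apply (piElt E)
  have hreg : ∀ {x y : Rpi E}, piElt E * x = piElt E * y → x = y := fun {x y} h =>
    sub_eq_zero.1 (pi_regular E _ (by rw [mul_sub, h, sub_self]))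
  -- The element σ(π) is regular because it divides the regular element π.
  have hreg' : ∀ {x y : Rpi E}, σ (piElt E) * x = σ (piElt E) * y → x = y := fun {x y} h =>
    hreg (by rw [← hw, mul_right_comm, h, mul_right_comm])
  have hc : piElt E * (piBase E).c = p := (piBase E).ϖ_mul_c
  have hδ : ∀ x, piElt E * (piBase E).δ x = phiRpi E x - x ^ p :=
    DeltaBase.ofFrobenius_δ (piElt E) (pi_regular E) (pi_dvd_p E) (phiRpi E) (pi_dvd_phiRpi_sub E)
  refine ⟨σ v, hw, hreg' ?_, fun r => hreg' ?_⟩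
  · rw [← map_mul, hc, ← mul_assoc, hw, hc, map_natCast]
  · rw [← map_mul, hδ, ← mul_assoc, hw, hδ, map_sub, map_pow, hσ, extendRpi_phi]
    rfl

/-! ### Traces as sums of conjugates, and the trace of 1 -/

/-- The trace of `ℤ_p[π]` is the sum of the conjugates. -/
lemma sum_galRestrict [IsGalois ℚ_[p] (QpPi E)] (x : ZpPi E) :
    ∑ σ : QpPi E ≃ₐ[ℚ_[p]] QpPi E, galRestrict ℤ_[p] ℚ_[p] (QpPi E) (ZpPi E) σ x =
      algebraMap ℤ_[p] _ (Algebra.trace ℤ_[p] (ZpPi E) x) := by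
  -- The comparison is made in ℚ_p(π), where the trace of a Galois extension is the sum of the
  -- automorphisms and agrees with the trace of ℤ_p[π] by base change.
  apply IsIntegralClosure.algebraMap_injective (ZpPi E) ℤ_[p] (QpPi E)
  rw [map_sum]
  simp only [algebraMap_galRestrict_apply]
  rw [← trace_eq_sum_automorphisms, ← IsScalarTower.algebraMap_apply,
    IsScalarTower.algebraMap_apply ℤ_[p] ℚ_[p], ← trace_adjoinRoot_map _ E.monic]
  rfl

/-- The trace of `R_π` over `R_p` is the sum of the conjugates. -/
lemma sum_extendRpiEquiv [IsGalois ℚ_[p] (QpPi E)] (r : Rpi E) :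
    ∑ σ : QpPi E ≃ₐ[ℚ_[p]] QpPi E,
        extendRpiEquiv E (galRestrict ℤ_[p] ℚ_[p] (QpPi E) (ZpPi E) σ) r =
      algebraMap (Rp p) _ (Algebra.trace (Rp p) (Rpi E) r) := by
  have h : ∀ x : ZpPi E, ∑ σ : QpPi E ≃ₐ[ℚ_[p]] QpPi E,
      extendRpiEquiv E (galRestrict ℤ_[p] ℚ_[p] (QpPi E) (ZpPi E) σ) (zpPiToRpi E x) =
      algebraMap (Rp p) _ (Algebra.trace (Rp p) (Rpi E) (zpPiToRpi E x)) := fun x => by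
    have h1 : Algebra.trace (Rp p) (Rpi E) (zpPiToRpi E x) =
      zpToRp p (Algebra.trace ℤ_[p] (ZpPi E) x) := trace_adjoinRoot_map (zpToRp p) E.monic x
    rw [h1, ← zpPiToRpi_algebraMap, ← sum_galRestrict, map_sum]
    exact Finset.sum_congr rfl fun σ _ => extendRpi_zpPiToRpi E _ x
  have : ∑ σ : QpPi E ≃ₐ[ℚ_[p]] QpPi E,
      (extendRpiEquiv E (galRestrict ℤ_[p] ℚ_[p] (QpPi E) (ZpPi E) σ)).toLinearMap =
      (Algebra.linearMap (Rp p) (Rpi E)).comp (Algebra.trace (Rp p) (Rpi E)) := by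
    -- Both sides are R_p-linear, and R_π has the R_p-basis of powers of π, which come from ℤ_p[π],
    -- where the formula is `h`.
    refine (AdjoinRoot.powerBasis' (E.monic.map (zpToRp p))).basis.ext fun i => ?_
    have hi : (AdjoinRoot.powerBasis' (E.monic.map (zpToRp p))).basis i =
        zpPiToRpi E (AdjoinRoot.root E.poly ^ (i : ℕ)) := by
      rw [PowerBasis.basis_eq_pow, map_pow, zpPiToRpi_root]; rfl
    rw [hi, LinearMap.sum_apply]
    exact h _
  have h2 := congrArg (fun k => k r) this
  simp only [LinearMap.sum_apply] at h2
  exact h2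

/-- The degree of `R_π` over `R_p` is a power of `p` up to a unit. -/
lemma exists_mul_trace_one : ∃ (r : Rp p) (k : ℕ),
    r * Algebra.trace (Rp p) (Rpi E) 1 = (p : Rp p) ^ k := by
  have hp : p.Prime := Fact.out
  have he : E.poly.natDegree ≠ 0 := by have := E.two_le_natDegree; omega
  obtain ⟨k, m, hm, hkm⟩ := Nat.exists_eq_pow_mul_and_not_dvd he p hp.ne_one
  have htr : Algebra.trace (Rp p) (Rpi E) 1 = (E.poly.natDegree : Rp p) := by
    have := Algebra.trace_algebraMap_of_basis
      (AdjoinRoot.powerBasis' (E.monic.map (zpToRp p))).basis (1 : Rp p)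
    rw [map_one] at this
    rw [this, AdjoinRoot.powerBasis'_dim, Fintype.card_fin, E.monic.natDegree_map]
    simp
  have hu : IsUnit (m : Rp p) := by
    -- With e = p^k m and p ∤ m, the factor m is nonzero in the residue field; r is its inverse.
    apply WittVector.isUnit_of_coeff_zero_ne_zero
    change WittVector.constantCoeff (m : Rp p) ≠ 0
    rwa [map_natCast, Ne, CharP.cast_eq_zero_iff (AlgebraicClosure (ZMod p)) p]
  obtain ⟨r, hr⟩ := hu.exists_left_inv
  refine ⟨r, k, ?_⟩
  rw [htr, hkm, Nat.cast_mul, Nat.cast_pow, mul_left_comm, hr, mul_one]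

end PiJet

end

/-! ### The equivalence -/

theorem proposition2p3 (p : ℕ) [Fact p.Prime] (hp : 5 ≤ p)
    (E : PiJet.EisensteinPoly p) (hE : IsGalois ℚ_[p] (PiJet.QpPi E))
    (X : AlgebraicGeometry.Scheme.{0})
    (s : X ⟶ AlgebraicGeometry.Spec (CommRingCat.of (PiJet.Rp p)))
    [AlgebraicGeometry.Smooth s] (n : ℕ) (f : PiJet.JetFun s (PiJet.pBase p) n) :
    (∃ (ν : ℕ) (g : PiJet.JetFun (PiJet.baseChangeSnd s (PiJet.Rpi E)) (PiJet.piBase E) n),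
        PiJet.arithTrace (PiJet.isExt E) s n g = (p : PiJet.JetFun s (PiJet.pBase p) n) ^ ν * f) ↔
      (∃ (ν : ℕ) (g : PiJet.JetFun (PiJet.baseChangeSnd s (PiJet.Rpi E)) (PiJet.piBase E) n),
        PiJet.jetInclusion (PiJet.isExt E) s n g =
          1 ⊗ₜ[PiJet.Rp p] ((p : PiJet.JetFun s (PiJet.pBase p) n) ^ ν * f)) := by
  constructor
  · rintro ⟨ν, g, hg⟩
    obtain ⟨g', hg'⟩ := PiJet.exists_jetInclusion_eq_arithTrace (PiJet.isExt E) s n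
      (fun σ : PiJet.QpPi E ≃ₐ[ℚ_[p]] PiJet.QpPi E =>
        PiJet.extendRpiEquiv E (galRestrict ℤ_[p] ℚ_[p] (PiJet.QpPi E) (PiJet.ZpPi E) σ))
      (PiJet.sum_extendRpiEquiv E) (fun σ => PiJet.exists_isTwist E _) g
    exact ⟨ν, g', hg'.trans (by rw [hg])⟩
  · rintro ⟨ν, g, hg⟩
    obtain ⟨r, k, hr⟩ := PiJet.exists_mul_trace_one E
    -- Here r is the inverse of the prime-to-p part of e and p^k its p-part, so the trace of r g is
    -- r e p^ν f = p^(k + ν) f.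
    refine ⟨k + ν, algebraMap (PiJet.Rp p) (PiJet.Rpi E) r • g, ?_⟩
    rw [PiJet.arithTrace_smul_of_jetInclusion_eq (PiJet.isExt E) s n r g _ hg, hr,
      Algebra.smul_def, map_pow, map_natCast, pow_add, mul_assoc]
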